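/- A \emph{turn-based reachability game} consists of a set of vertices partitioned into Player 1 and Player 2 vertices, directed edges, and a target set. A strategy of a player is memoryless: it chooses a neighbor at each of the player's vertices that has one. A play is infinite or ends in a vertex without neighbors; Player 1 wins from $x$ if he has a strategy such that against every strategy of Player 2 the play from $x$ reaches the target set. A \emph{pawn game} with $d$ pawns is $\mathcal G=\langle V,E,T\rangle$ with $V=V_1\cup\dots\cup V_d$ finite, $E\subseteq V\times V$ and $T\subseteq V$, where pawn $j$ owns the vertices in $V_j$. It is \emph{OVPP} (one vertex per pawn) if $|V|=d$ and each $V_j$ is a singleton. For $k\in\mathbb N$, the \emph{$k$-grabbing game} on $\mathcal G$ is the following turn-based reachability game. Its vertices are the configurations $c=\langle v,P,r\rangle$ with $v\in V$, $P\subseteq\{1,\dots,d\}$ (the pawns that Player 1 controls) and $0\le r\le k$ (the remaining grabs), and the intermediate vertices $\langle v',c\rangle$ with $v'\in V$. A configuration $\langle v,P,r\rangle$ belongs to Player 1 iff $v\in V_j$ for some $j\in P$; its neighbors are the $\langle v',\langle v,P,r\rangle\rangle$ with $E(v,v')$. An intermediate vertex $\langle v',\langle v,P,r\rangle\rangle$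 belongs to Player 1; its neighbors are $\langle v',P,r\rangle$ (no grab) and, if $r>0$, the $\langle v',P\cup\{j\},r-1\rangle$ with $j\notin P$ (grab of pawn $j$). The target set consists of the configurations with $v\in T$. Player 1 \emph{wins the $k$-grabbing game from $\langle v_0,P_0\rangle$} if he wins from $\langle v_0,P_0,k\rangle$. \textbf{Theorem.} The problem \emph{OVPP $k$-grabbing PAWN-GAMES} (given an OVPP pawn game $\mathcal G$, an initial configuration $\langle v_0,P_0\rangle$ and a number $k\in\mathbb N$ in binary, decide whether Player 1 wins the $k$-grabbing game on $\mathcal G$ from $\langle v_0,P_0\rangle$) is in PTIME. Moreover, for an OVPP pawn game $\mathcal G$ and a set $P_0$ of pawns, let $\eta(u)\in\mathbb N\cup\{\infty\}$, for $u\in V$, be the minimum number $k$ such that Player 1 wins the $k$-grabbing game on $\mathcal G$ from $\langle u,P_0\rangle$, with $\eta(u)=\infty$ if there is no such $k$. Then, for every $k\in\mathbb N$, Player 1 wins the $k$-grabbing game from $\langle u,P_0\rangle$ if and only if $\eta(u)\le k$; and the table of the values $\eta(u)$, $u\in V$, can be computed from $\mathcal G$ and $P_0$ in polynomial time. -/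

import Mathlib

/-! ## Turn-based reachability games -/

/-- A turn-based reachability game. The set `V₁` holds the vertices of Player 1, its complement
those of Player 2; Player 1 wants to reach `T`, Player 2 wants to avoid it. -/
structure TurnBasedGame (V : Type*) where
  V₁ : Set V
  E : V → V → Prop
  T : Set V

namespace TurnBasedGame

variable {V : Type*}

/-- A (memoryless) strategy of the player who owns the vertices in `own`: it prescribes a neighbor
at each of these vertices that has one. Its values elsewhere play no role. -/
def IsStrategy (G : TurnBasedGame V) (own : Set V) (f : V → V) : Prop :=
  ∀ v ∈ own, (∃ u, G.E v u) → G.E v (f v)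

open Classical in
/-- The play from `v₀` under the strategies `f₁` and `f₂`: a path that is infinite, or ends in a
vertex without neighbors (the value is `none` after the end of the play). -/
noncomputable def play (G : TurnBasedGame V) (v₀ : V) (f₁ f₂ : V → V) : ℕ → Option V
  | 0 => some v₀
  | j + 1 => (G.play v₀ f₁ f₂ j).bind fun v =>
      if ∃ u, G.E v u then some (if v ∈ G.V₁ then f₁ v else f₂ v) else none

/-- The strategy `f₁` of Player 1 is winning from `v₀`: against every strategy of Player 2, the play
reaches `T`. -/
def IsWinning (G : TurnBasedGame V) (v₀ : V) (f₁ : V → V) : Prop :=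
  ∀ f₂, G.IsStrategy G.V₁ᶜ f₂ → ∃ j, ∃ v ∈ G.T, G.play v₀ f₁ f₂ j = some v

/-- Player 1 wins from `v₀`. -/
def Player1Wins (G : TurnBasedGame V) (v₀ : V) : Prop :=
  ∃ f₁, G.IsStrategy G.V₁ f₁ ∧ G.IsWinning v₀ f₁

end TurnBasedGame

/-! ## Pawn games and the k-grabbing mechanism -/

/-- A pawn game with `d` pawns (without its mechanism): `owned j` is the set of vertices that
pawn `j` owns. -/
structure PawnGame (V : Type*) (d : ℕ) where
  E : V → V → Prop
  T : Set V
  owned : Fin d → Set V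
  cover : ⋃ j, owned j = Set.univ

/-- A configuration of a k-grabbing game: the position of the token, the set of pawns that Player 1
controls, and the number of remaining grabs. -/
structure KConfig (V : Type*) (d k : ℕ) where
  pos : V
  pawns : Finset (Fin d)
  grabs : Fin (k + 1)

/-- The vertices of the explicit turn-based game: configuration vertices `c`, and intermediate
vertices `⟨v', c⟩`, reached when the token has been moved from `c` to `v'`. -/
inductive KVertex (V : Type*) (d k : ℕ)
  | config (c : KConfig V d k)
  | inter (v' : V) (c : KConfig V d k)

namespace PawnGame

variable {V : Type*} {d : ℕ}

/-- One vertex per pawn. -/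
def IsOVPP [Fintype V] (G : PawnGame V d) : Prop :=
  Fintype.card V = d ∧ ∀ j, ∃ v, G.owned j = {v}

/-- The edges of the explicit game of `G` under k-grabbing. From an intermediate vertex, Player 1
either does not grab, or he grabs one of the pawns of Player 2, if he has a grab left. -/
def kEdge (G : PawnGame V d) (k : ℕ) : KVertex V d k → KVertex V d k → Prop
  | .config c, .inter v' c' => c' = c ∧ G.E c.pos v'
  | .inter v' c, .config c' =>
      c'.pos = v' ∧
        ((c'.pawns = c.pawns ∧ c'.grabs = c.grabs) ∨
          ∃ j ∉ c.pawns, c'.pawns = insert j c.pawns ∧ (c'.grabs : ℕ) + 1 = c.grabs)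
  | _, _ => False

/-- The turn-based game that corresponds to `G` under k-grabbing. -/
def kGrabbing (G : PawnGame V d) (k : ℕ) : TurnBasedGame (KVertex V d k) where
  V₁ := {x | match x with
    | .config c => ∃ j ∈ c.pawns, c.pos ∈ G.owned j
    | .inter _ _ => True}
  E := G.kEdge k
  T := {x | match x with
    | .config c => c.pos ∈ G.T
    | .inter _ _ => False}

/-- Player 1 wins the k-grabbing game on `G` from the initial configuration `⟨v₀, P₀⟩`. -/
def WinsKGrabbing (G : PawnGame V d) (k : ℕ) (v₀ : V) (P₀ : Finset (Fin d)) : Prop :=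
  (G.kGrabbing k).Player1Wins (.config ⟨v₀, P₀, Fin.last k⟩)

/-- The minimum number of grabs with which Player 1 wins from `⟨u, P₀⟩`; it is `⊤` if no number of
grabs suffices. -/
noncomputable def minGrabs (G : PawnGame V d) (P₀ : Finset (Fin d)) (u : V) : ℕ∞ :=
  sInf {m : ℕ∞ | ∃ k : ℕ, m = k ∧ G.WinsKGrabbing k u P₀}

end PawnGame

/-! ## Inputs -/

/-- An OVPP pawn game on the vertices `0, …, n - 1`, with a set `P₀` of pawns that Player 1 controls
initially. -/
structure OVPPGame where
  n : ℕ
  d : ℕ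
  game : PawnGame (Fin n) d
  isOVPP : game.IsOVPP
  P₀ : Finset (Fin d)

/-- An input of the problem OVPP k-grabbing PAWN-GAMES: an OVPP pawn game, an initial configuration
`⟨v₀, P₀⟩`, and the number `k` of grabs. -/
structure OVPPKGrabbingInput extends OVPPGame where
  v₀ : Fin n
  k : ℕ

/-- The question of the problem OVPP k-grabbing PAWN-GAMES. -/
def OVPPKGrabbingInput.Player1Wins (I : OVPPKGrabbingInput) : Prop :=
  I.game.WinsKGrabbing I.k I.v₀ I.P₀

/-! ## Encodings as strings -/

section Encoding

open Computability

/-- A row of bits, closed by a comma. -/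
def encodeRow (l : List Bool) : List Γ' := l.map Γ'.bit ++ [Γ'.comma]

/-- A list of rows, closed by a bracket. -/
def encodeRows (L : List (List Bool)) : List Γ' := L.flatMap encodeRow ++ [Γ'.ket]

open Classical in
/-- The bits of a subset of `Fin n`. -/
noncomputable def bitsOf {n : ℕ} (s : Fin n → Prop) : List Bool := List.ofFn fun i => decide (s i)

/-- The characteristic vector of `T`, the adjacency matrix, the characteristic vector of `P₀`, and
for each pawn the characteristic vector of the set of vertices that it owns. -/
noncomputable def OVPPGame.encode (G : OVPPGame) : List Γ' :=
  encodeRow (bitsOf (· ∈ G.game.T)) ++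
    (encodeRows (List.ofFn fun u => bitsOf fun v => G.game.E u v) ++
      (encodeRow (bitsOf (· ∈ G.P₀)) ++
        encodeRows (List.ofFn fun j => bitsOf (· ∈ G.game.owned j))))

/-- The game, then `v₀` as the characteristic vector of its singleton, then `k` in binary. -/
noncomputable def OVPPKGrabbingInput.encode (I : OVPPKGrabbingInput) : List Γ' :=
  I.toOVPPGame.encode ++ (encodeRow (bitsOf (· = I.v₀)) ++ encodeRow (encodeNat I.k))

/-- A number in unary as a row of ones; `⊤` as the row with the single bit zero. -/
def encodeENat : ℕ∞ → List Γ'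
  | none => encodeRow [false]
  | some m => encodeRow (List.replicate m true)

/-- A list of extended natural numbers, entry by entry. -/
def encodeENats (l : List ℕ∞) : List Γ' := l.flatMap encodeENat

/-! The encodings determine the encoded objects. -/

theorem encodeRow_append_inj : ∀ {l l' : List Bool} {t t' : List Γ'},
    encodeRow l ++ t = encodeRow l' ++ t' → l = l' ∧ t = t'
  | [], [], _, _, h => by simpa [encodeRow] using h
  | [], _ :: _, _, _, h => by simp [encodeRow] at h
  | _ :: _, [], _, _, h => by simp [encodeRow] at h
  | a :: l, b :: l', t, t', h => by
      have h' : a = b ∧ encodeRow l ++ t = encodeRow l' ++ t' := by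
        simpa [encodeRow] using h
      obtain ⟨h1, h2⟩ := encodeRow_append_inj h'.2
      exact ⟨by rw [h'.1, h1], h2⟩

theorem encodeRow_ne_ket {l : List Bool} {t t' : List Γ'} : encodeRow l ++ t ≠ Γ'.ket :: t' := by
  cases l <;> simp [encodeRow]

theorem encodeRows_append_inj : ∀ {L L' : List (List Bool)} {t t' : List Γ'},
    encodeRows L ++ t = encodeRows L' ++ t' → L = L' ∧ t = t'
  | [], [], _, _, h => by simpa [encodeRows] using h
  | [], _ :: _, _, _, h => by
      simp only [encodeRows, List.flatMap_nil, List.nil_append, List.flatMap_cons,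
        List.append_assoc, List.singleton_append] at h
      exact absurd h.symm encodeRow_ne_ket
  | _ :: _, [], _, _, h => by
      simp only [encodeRows, List.flatMap_nil, List.nil_append, List.flatMap_cons,
        List.append_assoc, List.singleton_append] at h
      exact absurd h encodeRow_ne_ket
  | l :: L, l' :: L', t, t', h => by
      have h' : encodeRow l ++ (encodeRows L ++ t) = encodeRow l' ++ (encodeRows L' ++ t') := by
        simpa [encodeRows] using h
      obtain ⟨h1, h2⟩ := encodeRow_append_inj h'
      obtain ⟨h3, h4⟩ := encodeRows_append_inj h2
      exact ⟨by rw [h1, h3], h4⟩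

theorem bitsOf_length {n : ℕ} (s : Fin n → Prop) : (bitsOf s).length = n := by simp [bitsOf]

theorem bitsOf_inj {n : ℕ} {s t : Fin n → Prop} (h : bitsOf s = bitsOf t) : s = t := by
  have h' := List.ofFn_injective h
  funext i
  simpa using congrFun h' i

theorem OVPPGame.encode_append_inj {G H : OVPPGame} {t t' : List Γ'}
    (h : G.encode ++ t = H.encode ++ t') : G = H ∧ t = t' := by
  obtain ⟨n, d, ⟨E, T, O, c⟩, o, P⟩ := G
  obtain ⟨n', d', ⟨E', T', O', c'⟩, o', P'⟩ := H
  simp only [OVPPGame.encode, List.append_assoc] at h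
  obtain ⟨h1, r1⟩ := encodeRow_append_inj h
  obtain ⟨h2, r2⟩ := encodeRows_append_inj r1
  obtain ⟨h3, r3⟩ := encodeRow_append_inj r2
  obtain ⟨h4, r4⟩ := encodeRows_append_inj r3
  have hn : n = n' := by simpa only [bitsOf_length] using congrArg List.length h1
  have hd : d = d' := by simpa only [bitsOf_length] using congrArg List.length h3
  clear h r1 r2 r3
  subst hn hd
  refine ⟨?_, r4⟩
  have e1 : T = T' := bitsOf_inj h1
  have e2 : E = E' := by
    funext u
    exact bitsOf_inj (congrFun (List.ofFn_injective h2) u)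
  have e3 : P = P' := by
    ext j
    exact iff_of_eq (congrFun (bitsOf_inj h3) j)
  have e4 : O = O' := by
    funext j
    exact bitsOf_inj (congrFun (List.ofFn_injective h4) j)
  subst e1 e2 e3 e4
  rfl

theorem OVPPGame.encode_injective : Function.Injective OVPPGame.encode := fun G H h =>
  (OVPPGame.encode_append_inj (t := []) (t' := []) (by rw [h])).1

theorem OVPPKGrabbingInput.encode_injective : Function.Injective OVPPKGrabbingInput.encode := by
  rintro ⟨G, v, k⟩ ⟨H, w, k'⟩ h
  obtain ⟨h1, r1⟩ := OVPPGame.encode_append_inj h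
  obtain ⟨h2, r2⟩ := encodeRow_append_inj r1
  have r2' : encodeRow (encodeNat k) ++ [] = encodeRow (encodeNat k') ++ [] := by
    rw [List.append_nil, List.append_nil]
    exact r2
  have h3 : k = k' := by
    simpa only [decode_encodeNat] using congrArg decodeNat (encodeRow_append_inj r2').1
  clear h r1 r2 r2'
  simp only at h1
  subst h1 h3
  have h4 : v = w := (iff_of_eq (congrFun (bitsOf_inj h2) v)).1 rfl
  rw [h4]

theorem encodeENats_injective : Function.Injective encodeENats := by
  have key : ∀ a : ℕ∞, ∃ r, encodeENat a = encodeRow r := by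
    rintro (_ | m)
    exacts [⟨_, rfl⟩, ⟨_, rfl⟩]
  intro l
  induction l with
  | nil =>
    rintro (_ | ⟨b, l'⟩) h
    · rfl
    · obtain ⟨r, hr⟩ := key b
      simp [encodeENats, hr, encodeRow] at h
  | cons a l ih =>
    rintro (_ | ⟨b, l'⟩) h
    · obtain ⟨r, hr⟩ := key a
      simp [encodeENats, hr, encodeRow] at h
    · have h' : encodeENat a ++ encodeENats l = encodeENat b ++ encodeENats l' := h
      have hab : a = b ∧ encodeENats l = encodeENats l' := by
        rcases a with _ | m <;> rcases b with _ | m' <;>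
          obtain ⟨h1, h2⟩ := encodeRow_append_inj h'
        · exact ⟨rfl, h2⟩
        · rcases m' with _ | m' <;> simp [List.replicate_succ] at h1
        · rcases m with _ | m <;> simp [List.replicate_succ] at h1
        · have : m = m' := by simpa using congrArg List.length h1
          exact ⟨by rw [this], h2⟩
      rw [hab.1, ih hab.2]

end Encoding

/-! ## Polynomial time -/

open Classical in
/-- The decision problem `P`, with instances encoded by `enc`, is in PTIME: some multi-stack Turing
machine decides it, in a number of steps that is polynomial in the length of the encoding. -/
def InPTIME {α Γ : Type} (enc : α → List Γ) (P : α → Prop) : Prop :=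
  Nonempty (Turing.TM2ComputableInPolyTime enc Computability.encodeBool fun a => decide (P a))

/-- The function `f` is computable in polynomial time, for the given encodings. -/
def PolyTimeComputable {α β Γ Δ : Type} (enc : α → List Γ) (enc' : β → List Δ) (f : α → β) : Prop :=
  Nonempty (Turing.TM2ComputableInPolyTime enc enc' f)

/-! ## A language of stack programs, compiled to multi-stack Turing machines -/

/-! The number of sets of controlled pawns is exponential, so the explicit game cannot simply be
solved. With one vertex per pawn the sets can be forgotten, because a grab may be postponed until
the token enters the grabbed vertex and then needs to serve for a single visit only. Suppose that
Player 1 wins with `r` grabs if he also controls `x` for free. Looking at the last time at which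
this control is used, either it is not needed at all, or some successor of `x` is won with `r` grabs
and without control of `x` (`EntryWins.of_insert`). In the latter case he can pay one grab at the
first visit to `x` and go straight to that successor, so free control of `x` is worth at most one
grab (`EntryWins.succ_of_insert`).

Hence the game is equivalent to one on pairs of a vertex and a number of remaining grabs, where the
vertices of the pawns in `P₀` are free and each other use of a vertex is paid per visit: this is
`EntryWins`, or `ConfigWins` at the start. The equivalence `PawnGame.winsKGrabbing_iff_configWins`
rests on the description of winning by attractors, `TurnBasedGame.player1Wins_iff_attr`.

For a fixed number of grabs the winning set is a fixed point that is reached after `|V|` steps, and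
the set for one more grab arises from it by a monotone operation. So these sets stabilize after
`|V|` levels (`level_eq_of_card_le`), and every finite minimum is below `|V|`. The minimum is the
number of levels that fail (`PawnGame.minGrabs_eq`), and a number `k` of exponential size does no
harm.

Polynomial time refers to multi-stack Turing machines. Programs of a small language are compiled to
such machines with exact step counts (`StackProg.Run.steps`, `StackProg.polyTimeComputable`). The
table takes `n` rounds of about `n` steps, each quadratic in `n` (`StackProg.Exec.gameTable`). It is
then either written out (`StackProg.Exec.writeTable`), or its entry at `v₀` is subtracted, one by
one, from the binary number `k` (`StackProg.Exec.decideGrabs`). -/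

/-- Programs that work on stacks; the symbols of stack `k` are in `Γ k`. -/
inductive StackProg {K : Type} (Γ : K → Type) : Type
  /-- Do nothing. -/
  | skip : StackProg Γ
  /-- Push a symbol. -/
  | push (k : K) (x : Γ k) : StackProg Γ
  /-- Run two programs one after the other. -/
  | seq (p q : StackProg Γ) : StackProg Γ
  /-- Pop a stack, and go on with a program that depends on the result. -/
  | case (k : K) (f : Option (Γ k) → StackProg Γ) : StackProg Γ
  /-- Pop a stack, and stop or run a program that depends on the result and repeat. -/
  | loop (k : K) (exit : Option (Γ k) → Bool) (f : Option (Γ k) → StackProg Γ) : StackProg Γ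

namespace StackProg

open Turing Function

variable {K : Type} {Γ : K → Type}

/-- The labels of the machine that executes a program. -/
def Lab : StackProg Γ → Type
  | skip => Unit
  | push _ _ => Unit
  | seq p q => p.Lab ⊕ q.Lab
  | case _ f => Option (Σ x, (f x).Lab)
  | loop _ _ f => Option (Σ x, (f x).Lab)

/-- The label at which a program starts. -/
def entry : (p : StackProg Γ) → p.Lab
  | skip => ()
  | push _ _ => ()
  | seq p _ => .inl p.entry
  | case _ _ => none
  | loop _ _ _ => none

/-- There are finitely many labels. -/
@[reducible]
noncomputable def labFintype [∀ k, Fintype (Γ k)] : (p : StackProg Γ) → Fintype p.Lab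
  | skip => inferInstanceAs (Fintype Unit)
  | push _ _ => inferInstanceAs (Fintype Unit)
  | seq p q =>
    letI := p.labFintype
    letI := q.labFintype
    inferInstanceAs (Fintype (p.Lab ⊕ q.Lab))
  | case _ f =>
    letI := fun x => (f x).labFintype
    inferInstanceAs (Fintype (Option (Σ x, (f x).Lab)))
  | loop _ _ f =>
    letI := fun x => (f x).labFintype
    inferInstanceAs (Fintype (Option (Σ x, (f x).Lab)))

variable [DecidableEq K]

/-- The statements of the machine that executes a program, where `emb` embeds the labels of the
program into those of the machine, and `next` is the label at which the machine goes on. The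
machine remembers the last symbol that it popped from each stack. -/
def code {Λ : Type} : (p : StackProg Γ) → (p.Lab → Λ) → Λ → p.Lab →
    TM2.Stmt Γ Λ (∀ k, Option (Γ k))
  | skip, _, next, _ => .goto fun _ => next
  | push k x, _, next, _ => .push k (fun _ => x) (.goto fun _ => next)
  | seq p q, emb, _, .inl l => p.code (fun l => emb (.inl l)) (emb (.inr q.entry)) l
  | seq _ q, emb, next, .inr l => q.code (fun l => emb (.inr l)) next l
  | case k f, emb, _, none =>
      .pop k (fun v x => update v k x) (.goto fun v => emb (some ⟨v k, (f (v k)).entry⟩))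
  | case _ f, emb, next, some ⟨x, l⟩ => (f x).code (fun l => emb (some ⟨x, l⟩)) next l
  | loop k exit f, emb, next, none =>
      .pop k (fun v x => update v k x)
        (.goto fun v => if exit (v k) then next else emb (some ⟨v k, (f (v k)).entry⟩))
  | loop _ _ f, emb, _, some ⟨x, l⟩ => (f x).code (fun l => emb (some ⟨x, l⟩)) (emb none) l

/-! ### Execution of programs, and correctness of the compilation -/

/-- `p.Run S t S'`: from the stacks `S`, the program `p` ends with the stacks `S'`, after `t`
steps. -/
inductive Run : StackProg Γ → (∀ k, List (Γ k)) → ℕ → (∀ k, List (Γ k)) → Prop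
  | skip (S) : Run skip S 1 S
  | push (k x S) : Run (push k x) S 1 (update S k (x :: S k))
  | seq {p q S S₁ S₂ t₁ t₂} : Run p S t₁ S₁ → Run q S₁ t₂ S₂ → Run (seq p q) S (t₁ + t₂) S₂
  | case {k f S S' t} : Run (f (S k).head?) (update S k (S k).tail) t S' →
      Run (case k f) S (t + 1) S'
  | loop_exit {k exit f S} : exit (S k).head? = true →
      Run (loop k exit f) S 1 (update S k (S k).tail)
  | loop_step {k exit f S S₁ S₂ t₁ t₂} : exit (S k).head? = false →
      Run (f (S k).head?) (update S k (S k).tail) t₁ S₁ → Run (loop k exit f) S₁ t₂ S₂ →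
      Run (loop k exit f) S (t₁ + t₂ + 1) S₂

/-- `n` steps of a machine. -/
def Steps {Λ σ : Type} (M : Λ → TM2.Stmt Γ Λ σ) (c : TM2.Cfg Γ Λ σ) (n : ℕ)
    (c' : TM2.Cfg Γ Λ σ) : Prop :=
  (flip bind (TM2.step M))^[n] (some c) = some c'

theorem Steps.one {Λ σ : Type} {M : Λ → TM2.Stmt Γ Λ σ} {c c' : TM2.Cfg Γ Λ σ}
    (h : TM2.step M c = some c') : Steps M c 1 c' := h

theorem Steps.add {Λ σ : Type} {M : Λ → TM2.Stmt Γ Λ σ} {c c₁ c₂ : TM2.Cfg Γ Λ σ} {m n : ℕ}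
    (h₁ : Steps M c m c₁) (h₂ : Steps M c₁ n c₂) : Steps M c (m + n) c₂ := by
  unfold Steps at *
  rw [add_comm, iterate_add_apply, h₁, h₂]

theorem Steps.pop {Λ : Type} {M : Λ → TM2.Stmt Γ Λ (∀ k, Option (Γ k))} {l l' : Λ} {k : K}
    {g : Option (Γ k) → Λ} {v : ∀ k, Option (Γ k)} {S : ∀ k, List (Γ k)}
    (h : M l = .pop k (fun v x => update v k x) (.goto fun v => g (v k)))
    (hg : g (S k).head? = l') :
    Steps M ⟨some l, v, S⟩ 1 ⟨some l', update v k (S k).head?, update S k (S k).tail⟩ :=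
  Steps.one (by simp [h, hg])

/-- The machine, the embedding of labels and the continuation are arbitrary, so that the induction
hypothesis applies to a subprogram inside a larger machine. The initial memory `v` is arbitrary too:
a jump consults only the symbol that has just been popped. -/
theorem Run.steps {p : StackProg Γ} {S S' : ∀ k, List (Γ k)} {t : ℕ} (h : p.Run S t S') :
    ∀ {Λ : Type} (M : Λ → TM2.Stmt Γ Λ (∀ k, Option (Γ k))) (emb : p.Lab → Λ) (next : Λ),
      (∀ l, M (emb l) = p.code emb next l) → ∀ v, ∃ v',
        Steps M ⟨some (emb p.entry), v, S⟩ t ⟨some next, v', S'⟩ := by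
  induction h with
  | skip S =>
    intro Λ M emb next hM v
    exact ⟨v, Steps.one (by simp [hM, code])⟩
  | push k x S =>
    intro Λ M emb next hM v
    exact ⟨v, Steps.one (by simp [hM, code])⟩
  | seq _ _ ih₁ ih₂ =>
    intro Λ M emb next hM v
    obtain ⟨v₁, h₁⟩ := ih₁ M (fun l => emb (.inl l)) _ (fun l => hM (.inl l)) v
    obtain ⟨v₂, h₂⟩ := ih₂ M (fun l => emb (.inr l)) next (fun l => hM (.inr l)) v₁
    exact ⟨v₂, h₁.add h₂⟩
  | @case k f S S' t _ ih =>
    intro Λ M emb next hM v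
    obtain ⟨v₁, h₁⟩ := ih M (fun l => emb (some ⟨_, l⟩)) next (fun l => hM (some ⟨_, l⟩))
      (update v k (S k).head?)
    refine ⟨v₁, ?_⟩
    rw [add_comm]
    exact (Steps.pop (g := fun x => emb (some ⟨x, (f x).entry⟩)) (hM none) rfl).add h₁
  | @loop_exit k exit f S hs =>
    intro Λ M emb next hM v
    refine ⟨update v k (S k).head?, ?_⟩
    exact Steps.pop (g := fun x => if exit x then next else emb (some ⟨x, (f x).entry⟩)) (hM none)
      (if_pos hs)
  | @loop_step k exit f S S₁ S₂ t₁ t₂ hs _ _ ih₁ ih₂ =>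
    intro Λ M emb next hM v
    obtain ⟨v₁, h₁⟩ := ih₁ M (fun l => emb (some ⟨_, l⟩)) (emb none) (fun l => hM (some ⟨_, l⟩))
      (update v k (S k).head?)
    obtain ⟨v₂, h₂⟩ := ih₂ M emb next hM v₁
    refine ⟨v₂, ?_⟩
    rw [add_comm]
    exact (Steps.pop (g := fun x => if exit x then next else emb (some ⟨x, (f x).entry⟩)) (hM none)
      (if_neg (by simp [hs]))).add (h₁.add h₂)

/-- `p.Exec B S S'`: from the stacks `S`, the program `p` ends with the stacks `S'`, after at most
`B` steps. -/
def Exec (p : StackProg Γ) (B : ℕ) (S S' : ∀ k, List (Γ k)) : Prop := ∃ t ≤ B, p.Run S t S'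

/-- The machine that executes a program, and halts. -/
noncomputable def machine [Fintype K] [∀ k, Fintype (Γ k)] (p : StackProg Γ) (k₀ k₁ : K) :
    FinTM2 :=
  letI := p.labFintype
  { k₀ := k₀
    k₁ := k₁
    Γ := Γ
    Λ := Option p.Lab
    main := some p.entry
    σ := ∀ k, Option (Γ k)
    initialState := fun _ => none
    m := fun
      -- The required final configuration has the initial internal state, so the memory is erased
      -- before halting.
      | none => .load (fun _ _ => none) .halt
      | some l => p.code some none l }

/-- A function that is computed by a stack program in polynomial time is computed by a Turing
machine in polynomial time. -/
theorem polyTimeComputable [Fintype K] [∀ k, Fintype (Γ k)] (p : StackProg Γ) (k₀ k₁ : K)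
    {α β Γ₀ Γ₁ : Type} (e₀ : Γ k₀ ≃ Γ₀) (e₁ : Γ k₁ ≃ Γ₁) (enc : α → List Γ₀) (enc' : β → List Γ₁)
    (f : α → β) (time : Polynomial ℕ)
    (h : ∀ a, p.Exec (time.eval (enc a).length)
      (update (fun _ => []) k₀ ((enc a).map e₀.symm))
      (update (fun _ => []) k₁ ((enc' (f a)).map e₁.symm))) :
    PolyTimeComputable enc enc' f := by
  have key : ∀ a, ∃ t ≤ (time + 1).eval (enc a).length,
      (flip bind (p.machine k₀ k₁).step)^[t]
        (some (initList (p.machine k₀ k₁) ((enc a).map e₀.symm))) =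
      some (haltList (p.machine k₀ k₁) ((enc' (f a)).map e₁.symm)) := by
    intro a
    obtain ⟨t, ht, hr⟩ := h a
    obtain ⟨v, hv⟩ := hr.steps (p.machine k₀ k₁).m some none (fun _ => rfl) fun _ => none
    -- The additional step is the one that erases the memory and halts.
    refine ⟨t + 1, by simpa using ht, ?_⟩
    have h2 : Steps (p.machine k₀ k₁).m ⟨some none, v,
      update (fun _ => []) k₁ ((enc' (f a)).map e₁.symm)⟩ 1 ⟨none, fun _ => none,
      update (fun _ => []) k₁ ((enc' (f a)).map e₁.symm)⟩ := Steps.one rfl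
    have h3 := hv.add h2
    have e1 : initList (p.machine k₀ k₁) ((enc a).map e₀.symm) = ⟨some (some p.entry), fun _ => none,
        update (fun _ => []) k₀ ((enc a).map e₀.symm)⟩ := by
      unfold initList
      congr 1
      funext k
      by_cases hk : k = k₀
      · subst k
        exact (dif_pos rfl).trans (update_self (β := fun k => List (Γ k)) _ _ _).symm
      · rw [update_of_ne hk]
        exact dif_neg hk
    have e2 : haltList (p.machine k₀ k₁) ((enc' (f a)).map e₁.symm) = ⟨none, fun _ => none,
        update (fun _ => []) k₁ ((enc' (f a)).map e₁.symm)⟩ := by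
      unfold haltList
      congr 1
      funext k
      by_cases hk : k = k₁
      · subst k
        exact (dif_pos rfl).trans (update_self (β := fun k => List (Γ k)) _ _ _).symm
      · rw [update_of_ne hk]
        exact dif_neg hk
    rw [e1, e2]
    exact h3
  choose t ht hr using key
  exact ⟨{ tm := p.machine k₀ k₁
           inputAlphabet := e₀
           outputAlphabet := e₁
           time := time + 1
           outputsFun := fun a => { steps := t a, evals_in_steps := hr a, steps_le_m := ht a } }⟩

end StackProg

/-! ## Winning in a finite reachability game -/

namespace TurnBasedGame

variable {V : Type*}

/-- The attractor of the target set: the vertices from which Player 1 can force a visit. -/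
inductive Attr (G : TurnBasedGame V) : V → Prop
  | target {v} : v ∈ G.T → G.Attr v
  | exists_edge {v u} : v ∈ G.V₁ → G.E v u → G.Attr u → G.Attr v
  | forall_edge {v} : v ∉ G.V₁ → (∃ u, G.E v u) → (∀ u, G.E v u → G.Attr u) → G.Attr v

/-- The attractor, stratified by the number of moves that Player 1 needs. -/
def AttrIn (G : TurnBasedGame V) : ℕ → V → Prop
  | 0, v => v ∈ G.T
  | m + 1, v => G.AttrIn m v ∨ (v ∈ G.V₁ ∧ ∃ u, G.E v u ∧ G.AttrIn m u) ∨
      (v ∉ G.V₁ ∧ (∃ u, G.E v u) ∧ ∀ u, G.E v u → G.AttrIn m u)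

theorem AttrIn.mono {G : TurnBasedGame V} {m n : ℕ} (h : m ≤ n) {v : V} (hv : G.AttrIn m v) :
    G.AttrIn n v := by
  induction h with
  | refl => exact hv
  | step _ ih => exact .inl ih

/-- Finiteness matters at the vertices of Player 2, where the rank has to exceed the ranks of all
successors. -/
theorem Attr.exists_attrIn [Finite V] {G : TurnBasedGame V} {v : V} (h : G.Attr v) :
    ∃ m, G.AttrIn m v := by
  induction h with
  | target h => exact ⟨0, h⟩
  | exists_edge hv he _ ih =>
    obtain ⟨m, hm⟩ := ih
    exact ⟨m + 1, .inr (.inl ⟨hv, _, he, hm⟩)⟩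
  | forall_edge hv he _ ih =>
    choose! f hf using ih
    obtain ⟨M, hM⟩ := (Set.finite_range f).bddAbove
    exact ⟨M + 1, .inr (.inr ⟨hv, he, fun u hu => (hf u hu).mono (hM ⟨u, rfl⟩)⟩)⟩

-- Moving to a neighbor of least rank is a memoryless strategy, and under it the rank of the current
-- vertex decreases until the target is reached, whatever Player 2 does.
open Classical in
theorem Attr.player1Wins [Finite V] {G : TurnBasedGame V} {v₀ : V} (h : G.Attr v₀) :
    G.Player1Wins v₀ := by
  have key : ∀ v, ∃ w, (∃ u, G.E v u) → G.E v w ∧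
      ∀ m, (∃ u, G.E v u ∧ G.AttrIn m u) → G.AttrIn m w := by
    intro v
    by_cases hex : ∃ m, ∃ u, G.E v u ∧ G.AttrIn m u
    -- Minimality makes one neighbor good for all `m` at once; the choice therefore depends on the
    -- vertex alone.
    · obtain ⟨w, hw, hm⟩ := Nat.find_spec hex
      exact ⟨w, fun _ => ⟨hw, fun m h => hm.mono (Nat.find_min' hex h)⟩⟩
    · by_cases hu : ∃ u, G.E v u
      · obtain ⟨u, hu⟩ := hu
        exact ⟨u, fun _ => ⟨hu, fun m h => absurd ⟨m, h⟩ hex⟩⟩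
      · exact ⟨v, fun h => absurd h hu⟩
  choose f hf using key
  refine ⟨f, fun v _ hv => (hf v hv).1, fun f₂ hf₂ => ?_⟩
  have main : ∀ m j v, G.play v₀ f f₂ j = some v → G.AttrIn m v →
      ∃ j, ∃ v ∈ G.T, G.play v₀ f f₂ j = some v := by
    intro m
    induction m with
    | zero => exact fun j v hj hv => ⟨j, v, hv, hj⟩
    | succ m ih =>
      rintro j v hj (hv | ⟨hv, u, hu, hm⟩ | ⟨hv, hu, hm⟩)
      · exact ih j v hj hv
      · refine ih (j + 1) (f v) ?_ ((hf v ⟨u, hu⟩).2 m ⟨u, hu, hm⟩)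
        simp [play, hj, hv, show ∃ u, G.E v u from ⟨u, hu⟩]
      · refine ih (j + 1) (f₂ v) ?_ (hm _ (hf₂ v hv hu))
        simp [play, hj, hv, hu]
  obtain ⟨m, hm⟩ := h.exists_attrIn
  exact main m 0 v₀ rfl hm

-- Outside the attractor, Player 2 can stay outside at his own vertices, and Player 1 has no edge
-- into it at his. No finiteness is needed.
open Classical in
theorem Player1Wins.attr {G : TurnBasedGame V} {v₀ : V} (h : G.Player1Wins v₀) : G.Attr v₀ := by
  by_contra h₀
  obtain ⟨f₁, hf₁, hw⟩ := h
  have key : ∀ v, ∃ w, (∃ u, G.E v u) → G.E v w ∧ ((∃ u, G.E v u ∧ ¬ G.Attr u) → ¬ G.Attr w) := by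
    intro v
    by_cases hex : ∃ u, G.E v u ∧ ¬ G.Attr u
    · obtain ⟨u, hu, hn⟩ := hex
      exact ⟨u, fun _ => ⟨hu, fun _ => hn⟩⟩
    · by_cases hu : ∃ u, G.E v u
      · obtain ⟨u, hu⟩ := hu
        exact ⟨u, fun _ => ⟨hu, fun h => absurd h hex⟩⟩
      · exact ⟨v, fun h => absurd h hu⟩
  choose f₂ hf₂ using key
  obtain ⟨j, v, hv, hj⟩ := hw f₂ fun v _ hv => (hf₂ v hv).1
  have inv : ∀ j v, G.play v₀ f₁ f₂ j = some v → ¬ G.Attr v := by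
    intro j
    induction j with
    | zero =>
      intro v hv
      rw [play, Option.some.injEq] at hv
      exact hv ▸ h₀
    | succ j ih =>
      intro v hv
      rw [play, Option.bind_eq_some_iff] at hv
      obtain ⟨w, hw, hv⟩ := hv
      have hn := ih w hw
      split_ifs at hv with he h1
      · cases hv
        exact fun h => hn (.exists_edge h1 (hf₁ w h1 he) h)
      · cases hv
        refine (hf₂ w he).2 ?_
        by_contra! hall
        exact hn (.forall_edge h1 he hall)
  exact inv j v hj (.target hv)

theorem player1Wins_iff_attr [Finite V] {G : TurnBasedGame V} {v₀ : V} :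
    G.Player1Wins v₀ ↔ G.Attr v₀ :=
  ⟨Player1Wins.attr, Attr.player1Wins⟩

end TurnBasedGame

/-! ## The cost of winning a grabbing game with one vertex per pawn -/

section Cost

variable {V : Type*} (E : V → V → Prop) (T : Set V)

/-- Player 1 wins from the moment at which the token moves to the given vertex, if he controls the
vertices in `P` for free and pays one of his `r` grabs whenever he grabs the vertex that the token
moves to. -/
inductive EntryWins (P : Set V) : ℕ → V → Prop
  | target {r v} : v ∈ T → EntryWins P r v
  | exists_edge {r v w} : v ∈ P → E v w → EntryWins P r w → EntryWins P r v
  | forall_edge {r v} : (∃ w, E v w) → (∀ w, E v w → EntryWins P r w) → EntryWins P r v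
  | grab {r v w} : E v w → EntryWins P r w → EntryWins P (r + 1) v

/-- Player 1 wins from a configuration at the given vertex; compare `EntryWins`. -/
def ConfigWins (P : Set V) (r : ℕ) (v : V) : Prop :=
  -- There is no alternative with a grab: grabs take place only after a move, so the vertex at which
  -- the token starts cannot be bought in time.
  v ∈ T ∨ (v ∈ P ∧ ∃ w, E v w ∧ EntryWins E T P r w) ∨
    ((∃ w, E v w) ∧ ∀ w, E v w → EntryWins E T P r w)

variable {E T} {P : Set V} {r s : ℕ} {v x : V}

theorem EntryWins.mono (h : EntryWins E T P r v) (hs : r ≤ s) : EntryWins E T P s v := by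
  induction h generalizing s with
  | target h => exact .target h
  | exists_edge hv he _ ih => exact .exists_edge hv he (ih hs)
  | forall_edge he _ ih => exact .forall_edge he fun w hw => ih w hw hs
  | grab he _ ih =>
    obtain ⟨s, rfl⟩ := Nat.exists_eq_add_of_le' (Nat.one_le_of_lt hs)
    exact .grab he (ih (Nat.le_of_succ_le_succ hs))

theorem ConfigWins.mono (h : ConfigWins E T P r v) (hs : r ≤ s) : ConfigWins E T P s v := by
  rcases h with h | ⟨hv, w, hw, h⟩ | ⟨he, h⟩
  · exact .inl h
  · exact .inr (.inl ⟨hv, w, hw, h.mono hs⟩)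
  · exact .inr (.inr ⟨he, fun w hw => (h w hw).mono hs⟩)

theorem ConfigWins.entryWins (h : ConfigWins E T P r v) : EntryWins E T P r v := by
  rcases h with h | ⟨hv, w, hw, h⟩ | ⟨he, h⟩
  · exact .target h
  · exact .exists_edge hv hw h
  · exact .forall_edge he h

/-- Free control of `x` is useless until the token reaches `x` for the last time. -/
theorem EntryWins.of_insert (h : EntryWins E T (insert x P) r v) :
    EntryWins E T P r v ∨ ∃ w, E x w ∧ EntryWins E T P r w := by
  induction h with
  | target h => exact .inl (.target h)
  | exists_edge hv he _ ih =>
    rcases ih with ih | ih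
    · rcases hv with rfl | hv
      · exact .inr ⟨_, he, ih⟩
      · exact .inl (.exists_edge hv he ih)
    · exact .inr ih
  | @forall_edge r v he _ ih =>
    -- If no successor of `x` is won without control of `x`, the first alternative of the induction
    -- hypothesis holds at every successor of `v`.
    by_cases hx : ∃ w, E x w ∧ EntryWins E T P r w
    · exact .inr hx
    · exact .inl (.forall_edge he fun w hw => (ih w hw).resolve_right hx)
  | grab he _ ih =>
    rcases ih with ih | ⟨w, hw, ih⟩
    · exact .inl (.grab he ih)
    · exact .inr ⟨w, hw, ih.mono (Nat.le_succ _)⟩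

/-- Free control of one more vertex is worth at most one grab. -/
theorem EntryWins.succ_of_insert (h : EntryWins E T (insert x P) r v) :
    EntryWins E T P (r + 1) v := by
  induction h with
  | target h => exact .target h
  | exists_edge hv he h ih =>
    rcases hv with rfl | hv
    -- At the first use of `x` the single extra grab is spent. The next vertex is one that is won
    -- without `x`: either the move of the given strategy or the successor found by
    -- `EntryWins.of_insert`.
    · rcases h.of_insert with h | ⟨w, hw, h⟩
      · exact .grab he h
      · exact .grab hw h
    · exact .exists_edge hv he ih
  | forall_edge he _ ih => exact .forall_edge he ih
  | grab he _ ih => exact .grab he ih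

end Cost

namespace PawnGame

variable {V : Type*} {d k : ℕ}

/-- The vertices that Player 1 controls, if he controls the pawns in `P`. -/
def controlled (G : PawnGame V d) (P : Finset (Fin d)) : Set V := {v | ∃ j ∈ P, v ∈ G.owned j}

/-- Grabbed pawns stay with Player 1 in the real game, so he may control more than `P` and have more
than `r` grabs left. The statement allows for this surplus, and the induction checks that it never
hurts. -/
theorem attr_of_entryWins {G : PawnGame V d} {P : Set V} {r : ℕ} {v : V}
    (h : EntryWins G.E G.T P r v) : ∀ c : KConfig V d k, P ⊆ G.controlled c.pawns →
      r ≤ (c.grabs : ℕ) → (G.kGrabbing k).Attr (.inter v c) := by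
  induction h with
  | @target r v h =>
    intro c _ _
    exact .exists_edge (u := .config ⟨v, c.pawns, c.grabs⟩) trivial ⟨rfl, .inl ⟨rfl, rfl⟩⟩ (.target h)
  | @exists_edge r v w hv he _ ih =>
    intro c hP hr
    refine .exists_edge (u := .config ⟨v, c.pawns, c.grabs⟩) trivial ⟨rfl, .inl ⟨rfl, rfl⟩⟩ ?_
    exact .exists_edge (u := .inter w ⟨v, c.pawns, c.grabs⟩) (hP hv) ⟨rfl, he⟩ (ih _ hP hr)
  | @forall_edge r v he _ ih =>
    intro c hP hr
    refine .exists_edge (u := .config ⟨v, c.pawns, c.grabs⟩) trivial ⟨rfl, .inl ⟨rfl, rfl⟩⟩ ?_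
    obtain ⟨w, hw⟩ := he
    -- If Player 1 happens to control `v`, any of the winning successors will do.
    by_cases hv : v ∈ G.controlled c.pawns
    · exact .exists_edge (u := .inter w ⟨v, c.pawns, c.grabs⟩) hv ⟨rfl, hw⟩ (ih w hw _ hP hr)
    · refine .forall_edge hv ⟨.inter w _, rfl, hw⟩ ?_
      rintro (c' | ⟨w', c'⟩) hE
      · exact hE.elim
      · obtain ⟨rfl, hE⟩ := hE
        exact ih w' hE _ hP hr
  | @grab r v w he _ ih =>
    intro c hP hr
    obtain ⟨j, hj⟩ : ∃ j, v ∈ G.owned j := by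
      simpa using (G.cover ▸ Set.mem_univ v : v ∈ ⋃ j, G.owned j)
    -- A pawn that was bought at an earlier visit need not be paid for again; the grab is saved.
    by_cases hjP : j ∈ c.pawns
    · refine .exists_edge (u := .config ⟨v, c.pawns, c.grabs⟩) trivial ⟨rfl, .inl ⟨rfl, rfl⟩⟩ ?_
      exact .exists_edge (u := .inter w ⟨v, c.pawns, c.grabs⟩) ⟨j, hjP, hj⟩ ⟨rfl, he⟩
        (ih _ hP ((Nat.le_succ _).trans hr))
    · have hlt := c.grabs.isLt
      let c' : KConfig V d k := ⟨v, insert j c.pawns, ⟨c.grabs - 1, by omega⟩⟩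
      refine .exists_edge (u := .config c') trivial
        ⟨rfl, .inr ⟨j, hjP, rfl, Nat.sub_add_cancel (Nat.one_le_of_lt hr)⟩⟩ ?_
      refine .exists_edge (u := .inter w c') ⟨j, Finset.mem_insert_self _ _, hj⟩ ⟨rfl, he⟩
        (ih c' (fun y hy => ?_) (Nat.le_sub_of_add_le hr))
      obtain ⟨i, hi, hy⟩ := hP hy
      exact ⟨i, Finset.mem_insert_of_mem hi, hy⟩

theorem attr_of_configWins {G : PawnGame V d} {c : KConfig V d k}
    (h : ConfigWins G.E G.T (G.controlled c.pawns) c.grabs c.pos) :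
    (G.kGrabbing k).Attr (.config c) := by
  rcases h with h | ⟨hv, w, hw, h⟩ | ⟨⟨w, hw⟩, h⟩
  · exact .target h
  · exact .exists_edge (u := .inter w c) hv ⟨rfl, hw⟩ (attr_of_entryWins h c subset_rfl le_rfl)
  · by_cases hv : c.pos ∈ G.controlled c.pawns
    · exact .exists_edge (u := .inter w c) hv ⟨rfl, hw⟩
        (attr_of_entryWins (h w hw) c subset_rfl le_rfl)
    · refine .forall_edge hv ⟨.inter w c, rfl, hw⟩ ?_
      rintro (c' | ⟨w', c'⟩) hE
      · exact hE.elim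
      · obtain ⟨rfl, hE⟩ := hE
        exact attr_of_entryWins (h w' hE) c' subset_rfl le_rfl

theorem controlled_insert {G : PawnGame V d} {P : Finset (Fin d)} {j : Fin d} {x : V}
    (hj : G.owned j = {x}) : G.controlled (insert j P) = insert x (G.controlled P) := by
  ext v
  simp [controlled, hj]

/-- A grab of an arbitrary pawn, possibly far from the token, is traded by
`EntryWins.succ_of_insert` for one paid visit. -/
theorem entryWins_of_attr {G : PawnGame V d} (hG : ∀ j, ∃ x, G.owned j = {x})
    {y : KVertex V d k} (h : (G.kGrabbing k).Attr y) :
    match y with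
    | .config c => ConfigWins G.E G.T (G.controlled c.pawns) c.grabs c.pos
    | .inter v c => EntryWins G.E G.T (G.controlled c.pawns) c.grabs v := by
  induction h with
  | @target y h =>
    rcases y with c | ⟨v, c⟩
    · exact .inl h
    · exact h.elim
  | @exists_edge y z hy he _ ih =>
    rcases y with c | ⟨v, c⟩ <;> rcases z with c' | ⟨v', c'⟩
    · exact he.elim
    · obtain ⟨rfl, he⟩ := he
      exact .inr (.inl ⟨hy, v', he, ih⟩)
    · obtain ⟨rfl, ⟨h1, h2⟩ | ⟨j, _, h1, h2⟩⟩ := he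
      · have ih := ConfigWins.entryWins ih
        rwa [h1, h2] at ih
      · have ih := ConfigWins.entryWins ih
        -- One vertex per pawn is essential here: the grab enlarges the controlled set by the single
        -- vertex `x`.
        obtain ⟨x, hx⟩ := hG j
        rw [h1, controlled_insert hx] at ih
        simpa only [h2] using ih.succ_of_insert
    · exact he.elim
  | @forall_edge y hy he _ ih =>
    rcases y with c | ⟨v, c⟩
    · obtain ⟨c' | ⟨w, c'⟩, he⟩ := he
      · exact he.elim
      · obtain ⟨rfl, he⟩ := he
        exact .inr (.inr ⟨⟨w, he⟩, fun w hw => ih (.inter w c') ⟨rfl, hw⟩⟩)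
    · exact absurd trivial hy

instance [Finite V] : Finite (KConfig V d k) :=
  Finite.of_injective (fun c : KConfig V d k => (c.pos, c.pawns, c.grabs)) (by
    rintro ⟨a, b, c⟩ ⟨a', b', c'⟩ h
    simpa using h)

instance [Finite V] : Finite (KVertex V d k) :=
  Finite.of_injective
    (fun | .config c => .inl c | .inter v c => .inr (v, c) :
      KVertex V d k → KConfig V d k ⊕ V × KConfig V d k) (by
    rintro (c | ⟨v, c⟩) (c' | ⟨v', c'⟩) h <;> simp_all)

theorem winsKGrabbing_iff_configWins [Fintype V] {G : PawnGame V d} (hG : G.IsOVPP) {v₀ : V}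
    {P₀ : Finset (Fin d)} :
    G.WinsKGrabbing k v₀ P₀ ↔ ConfigWins G.E G.T (G.controlled P₀) k v₀ := by
  rw [WinsKGrabbing, TurnBasedGame.player1Wins_iff_attr]
  exact ⟨fun h => entryWins_of_attr hG.2 h, fun h => attr_of_configWins (c := ⟨_, _, Fin.last k⟩) h⟩

/-- A nonempty set of extended naturals contains its infimum, and winning is monotone in the number
of grabs, which is immediate for `ConfigWins`. -/
theorem minGrabs_le_iff [Fintype V] {G : PawnGame V d} (hG : G.IsOVPP) {P₀ : Finset (Fin d)}
    {u : V} : G.minGrabs P₀ u ≤ k ↔ G.WinsKGrabbing k u P₀ := by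
  refine ⟨fun h => ?_, fun h => sInf_le ⟨k, rfl, h⟩⟩
  have hne : {m : ℕ∞ | ∃ k : ℕ, m = k ∧ G.WinsKGrabbing k u P₀}.Nonempty := by
    by_contra hne
    rw [Set.not_nonempty_iff_eq_empty] at hne
    rw [minGrabs, hne, sInf_empty, top_le_iff] at h
    exact ENat.natCast_ne_top k h
  obtain ⟨m, hm, hw⟩ := csInf_mem hne
  rw [minGrabs, hm, Nat.cast_le] at h
  rw [winsKGrabbing_iff_configWins hG] at hw ⊢
  exact hw.mono h

end PawnGame

/-! ## Computation of the cost by levels -/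

section Level

variable {V : Type*} (E : V → V → Prop)

/-- The vertices of `D`, and those from which the owner of the vertices in `P` can force that the
next vertex is in `X`. -/
def stepSet (D P X : Set V) : Set V :=
  {v | v ∈ D ∨ ((∃ w, E v w ∧ w ∈ X) ∧ (v ∈ P ∨ ∀ w, E v w → w ∈ X))}

variable {E}

theorem stepSet_mono {D D' P X X' : Set V} (hD : D ⊆ D') (hX : X ⊆ X') :
    stepSet E D P X ⊆ stepSet E D' P X' := by
  rintro v (hv | ⟨⟨w, hw, hx⟩, hv | hv⟩)
  · exact .inl (hD hv)
  · exact .inr ⟨⟨w, hw, hX hx⟩, .inl hv⟩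
  · exact .inr ⟨⟨w, hw, hX hx⟩, .inr fun w hw => hX (hv w hw)⟩

theorem subset_iterate {f : Set V → Set V} (hf : Monotone f) {X : Set V} (hX : X ⊆ f X) (m : ℕ) :
    X ⊆ f^[m] X := hf.monotone_iterate_of_le_map hX (Nat.zero_le m)

/-- The iterates increase, and each of them that is not yet fixed gains an element; there is room
for at most `Nat.card V` gains. -/
theorem iterate_card_fixed [Finite V] {f : Set V → Set V} (hf : Monotone f) {X : Set V}
    (hX : X ⊆ f X) : f (f^[Nat.card V] X) = f^[Nat.card V] X := by
  have hm := hf.monotone_iterate_of_le_map hX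
  have key : ∀ m, f (f^[m] X) = f^[m] X ∨ m + 1 ≤ (f^[m + 1] X).ncard := by
    intro m
    induction m with
    | zero =>
      rw [or_iff_not_imp_left]
      intro h
      rw [Nat.succ_le_iff, Set.ncard_pos (Set.toFinite _), Set.nonempty_iff_ne_empty]
      rintro h0
      rw [Function.iterate_one] at h0
      rw [Function.iterate_zero, id, h0] at h
      exact h (Set.subset_eq_empty hX h0).symm
    | succ m ih =>
      rcases ih with ih | ih
      · left
        rw [Function.iterate_succ_apply', ih, ih]
      · rw [or_iff_not_imp_left]
        intro h
        have hlt : f^[m + 1] X ⊂ f^[m + 1 + 1] X := by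
          refine (hm (Nat.le_succ _)).ssubset_of_ne fun he => h ?_
          rw [← Function.iterate_succ_apply' f]
          exact he.symm
        exact ih.trans_lt (Set.ncard_lt_ncard hlt (Set.toFinite _))
  refine (key _).resolve_right fun h => ?_
  have := Set.ncard_le_card (f^[Nat.card V + 1] X)
  omega

variable (E)

/-- `level E T P (r + 1)` are the vertices from which Player 1 wins with `r` grabs, from the moment
at which the token moves there. -/
noncomputable def level (T P : Set V) : ℕ → Set V
  | 0 => ∅
  -- The index exceeds the number of grabs by one, so that the empty level `0` makes the case
  -- without grabs uniform. With `Set.univ` as controlled set, the inner step adds to `T` the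
  -- predecessors of the level below, that is, the vertices where paying one grab wins. The
  -- iteration starts from the level below rather than from the empty set.
  | r + 1 => (stepSet E (stepSet E T Set.univ (level T P r)) P)^[Nat.card V] (level T P r)

variable {E} {T P : Set V}

/-- The set of `EntryWins` is closed under the step and contains the set from which the iteration
starts, so it contains all iterates. -/
theorem entryWins_of_mem_level {r : ℕ} {v : V} (h : v ∈ level E T P (r + 1)) :
    EntryWins E T P r v := by
  induction r generalizing v with
  | zero =>
    have hs : stepSet E (stepSet E T Set.univ (level E T P 0)) P {v | EntryWins E T P 0 v} ⊆
        {v | EntryWins E T P 0 v} := by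
      rintro v ((hv | ⟨⟨w, hw, hx⟩, _⟩) | ⟨⟨w, hw, hx⟩, hv | hv⟩)
      · exact .target hv
      · exact hx.elim
      · exact .exists_edge hv hw hx
      · exact .forall_edge ⟨w, hw⟩ hv
    have key : ∀ m, (stepSet E (stepSet E T Set.univ (level E T P 0)) P)^[m] (level E T P 0) ⊆
        {v | EntryWins E T P 0 v} := by
      intro m
      induction m with
      | zero => exact Set.empty_subset _
      | succ m ih =>
        rw [Function.iterate_succ_apply']
        exact (stepSet_mono subset_rfl ih).trans hs
    exact key _ h
  | succ r ihr =>
    have hs : stepSet E (stepSet E T Set.univ (level E T P (r + 1))) P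
        {v | EntryWins E T P (r + 1) v} ⊆ {v | EntryWins E T P (r + 1) v} := by
      rintro v ((hv | ⟨⟨w, hw, hx⟩, _⟩) | ⟨⟨w, hw, hx⟩, hv | hv⟩)
      · exact .target hv
      · exact .grab hw (ihr hx)
      · exact .exists_edge hv hw hx
      · exact .forall_edge ⟨w, hw⟩ hv
    have key : ∀ m, (stepSet E (stepSet E T Set.univ (level E T P (r + 1))) P)^[m]
        (level E T P (r + 1)) ⊆ {v | EntryWins E T P (r + 1) v} := by
      intro m
      induction m with
      | zero => exact fun v hv => (ihr hv).mono (Nat.le_succ r)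
      | succ m ih =>
        rw [Function.iterate_succ_apply']
        exact (stepSet_mono subset_rfl ih).trans hs
    exact key _ h

variable [Finite V]

/-- The two inclusions need each other. A level is fixed by the step over the previous base, hence
contained in its image under the step over the larger new base, and this makes the next iteration
increasing. -/
theorem level_subset_and_subset (r : ℕ) : level E T P r ⊆ level E T P (r + 1) ∧
    level E T P r ⊆ stepSet E (stepSet E T Set.univ (level E T P r)) P (level E T P r) := by
  have hmono : ∀ D, Monotone (stepSet E D P) := fun D _ _ => stepSet_mono subset_rfl
  induction r with
  | zero => exact ⟨Set.empty_subset _, Set.empty_subset _⟩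
  | succ r ih =>
    have h : level E T P (r + 1) ⊆
        stepSet E (stepSet E T Set.univ (level E T P (r + 1))) P (level E T P (r + 1)) := by
      have := iterate_card_fixed (hmono (stepSet E T Set.univ (level E T P r))) ih.2
      calc level E T P (r + 1)
          = stepSet E (stepSet E T Set.univ (level E T P r)) P (level E T P (r + 1)) := this.symm
        _ ⊆ _ := stepSet_mono (stepSet_mono subset_rfl ih.1) subset_rfl
    exact ⟨subset_iterate (hmono _) h _, h⟩

theorem stepSet_level (r : ℕ) : stepSet E (stepSet E T Set.univ (level E T P r)) P
    (level E T P (r + 1)) = level E T P (r + 1) :=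
  iterate_card_fixed (fun _ _ => stepSet_mono subset_rfl) (level_subset_and_subset r).2

theorem mem_level_of_entryWins {r : ℕ} {v : V} (h : EntryWins E T P r v) :
    v ∈ level E T P (r + 1) := by
  induction h with
  | target h => exact (stepSet_level _).subset <| .inl (.inl h)
  | exists_edge hv he _ ih => exact (stepSet_level _).subset <| .inr ⟨⟨_, he, ih⟩, .inl hv⟩
  | forall_edge he _ ih =>
    obtain ⟨w, hw⟩ := he
    exact (stepSet_level _).subset <| .inr ⟨⟨w, hw, ih w hw⟩, .inr ih⟩
  | grab he _ ih => exact (stepSet_level _).subset <| .inl (.inr ⟨⟨_, he, ih⟩, .inl trivial⟩)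

theorem configWins_iff_mem {r : ℕ} {v : V} :
    ConfigWins E T P r v ↔ v ∈ stepSet E T P (level E T P (r + 1)) := by
  constructor
  · rintro (h | ⟨hv, w, hw, h⟩ | ⟨⟨w, hw⟩, h⟩)
    · exact .inl h
    · exact .inr ⟨⟨w, hw, mem_level_of_entryWins h⟩, .inl hv⟩
    · exact .inr ⟨⟨w, hw, mem_level_of_entryWins (h w hw)⟩,
        .inr fun w hw => mem_level_of_entryWins (h w hw)⟩
  · rintro (h | ⟨⟨w, hw, h⟩, hv | hv⟩)
    · exact .inl h
    · exact .inr (.inl ⟨hv, w, hw, entryWins_of_mem_level h⟩)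
    · exact .inr (.inr ⟨⟨w, hw⟩, fun w hw => entryWins_of_mem_level (hv w hw)⟩)

/-- The levels are themselves the iterates of a monotone map, started at the empty set, so
`iterate_card_fixed` applies a second time. -/
theorem level_eq_of_card_le {r : ℕ} (hr : Nat.card V ≤ r) :
    level E T P r = level E T P (Nat.card V) := by
  let f : Set V → Set V := fun X => (stepSet E (stepSet E T Set.univ X) P)^[Nat.card V] X
  have hmono : Monotone f := by
    intro X Y hXY
    have : ∀ m, (stepSet E (stepSet E T Set.univ X) P)^[m] X ⊆
        (stepSet E (stepSet E T Set.univ Y) P)^[m] Y := by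
      intro m
      induction m with
      | zero => exact hXY
      | succ m ih =>
        rw [Function.iterate_succ_apply', Function.iterate_succ_apply']
        exact stepSet_mono (stepSet_mono subset_rfl hXY) ih
    exact this _
  have hl : ∀ m, level E T P m = f^[m] ∅ := by
    intro m
    induction m with
    | zero => rfl
    | succ m ih =>
      rw [Function.iterate_succ_apply', ← ih]
      rfl
  have hfix := iterate_card_fixed hmono (Set.empty_subset (f ∅))
  obtain ⟨m, rfl⟩ := Nat.exists_eq_add_of_le' hr
  rw [hl, hl, Function.iterate_add_apply]
  exact Function.iterate_fixed hfix m

theorem configWins_iff_of_card_le {r : ℕ} {v : V} (hr : Nat.card V ≤ r + 1) :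
    ConfigWins E T P r v ↔ v ∈ stepSet E T P (level E T P (Nat.card V)) := by
  rw [configWins_iff_mem, level_eq_of_card_le hr]

end Level

/-! ## Programs on stacks of bits -/

open Computability Function

/-- The names of the stacks of bits. -/
inductive BitStack
  | edges | target | owned | ones | reach | base | won | table | rounds | pawns
  | edges' | base' | owned' | reach' | ones' | table' | acc | flag
  deriving DecidableEq

instance : Fintype BitStack where
  elems := {.edges, .target, .owned, .ones, .reach, .base, .won, .table, .rounds, .pawns, .edges',
    .base', .owned', .reach', .ones', .table', .acc, .flag}
  complete i := by cases i <;> decide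

/-- The names of the stacks. -/
inductive StackName
  | inp | out | bits (i : BitStack)
  deriving DecidableEq, Fintype

/-- The alphabet of each stack; that of the output stack is `Δ`. -/
@[reducible]
def Alphabet (Δ : Type) : StackName → Type
  | .inp => Γ'
  | .out => Δ
  | .bits _ => Bool

instance {Δ : Type} [Fintype Δ] : ∀ k, Fintype (Alphabet Δ k)
  | .inp => inferInstanceAs (Fintype Γ')
  | .out => inferInstanceAs (Fintype Δ)
  | .bits _ => inferInstanceAs (Fintype Bool)

/-- The stacks with the given contents. -/
def mem {Δ : Type} (a : List Γ') (o : List Δ) (w : BitStack → List Bool) :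
    ∀ k, List (Alphabet Δ k)
  | .inp => a
  | .out => o
  | .bits i => w i

namespace StackProg

variable {Δ : Type} {a : List Γ'} {o : List Δ} {w w' : BitStack → List Bool}
  {B B₁ B₂ : ℕ} {i j : BitStack}

theorem update_mem_bits (l : List Bool) :
    update (mem a o w) (.bits i) l = mem a o (update w i l) := by
  funext k
  rcases k with _ | _ | j
  · rfl
  · rfl
  · by_cases h : j = i
    · subst h
      simp [mem]
    · simp [mem, h]

theorem update_mem_inp (l : List Γ') : update (mem a o w) .inp l = mem l o w := by
  funext k
  rcases k with _ | _ | j <;> rfl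

theorem update_mem_out (l : List Δ) : update (mem a o w) .out l = mem a l w := by
  funext k
  rcases k with _ | _ | j <;> rfl

section General

variable {K : Type} {Γ : K → Type} [DecidableEq K] {p q : StackProg Γ} {S S' S₁ : ∀ k, List (Γ k)}

theorem Exec.mono (h : p.Exec B S S') (hB : B ≤ B₁) : p.Exec B₁ S S' := by
  obtain ⟨t, ht, hr⟩ := h
  exact ⟨t, ht.trans hB, hr⟩

theorem Exec.seq (h₁ : p.Exec B₁ S S₁) (h₂ : q.Exec B₂ S₁ S') :
    (p.seq q).Exec (B₁ + B₂) S S' := by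
  obtain ⟨t₁, ht₁, hr₁⟩ := h₁
  obtain ⟨t₂, ht₂, hr₂⟩ := h₂
  exact ⟨_, add_le_add ht₁ ht₂, .seq hr₁ hr₂⟩

theorem Exec.skip : (skip : StackProg Γ).Exec 1 S S := ⟨1, le_rfl, .skip S⟩

theorem Exec.loop_exit {k : K} {exit : Option (Γ k) → Bool} {f : Option (Γ k) → StackProg Γ}
    (h : exit (S k).head? = true) : (loop k exit f).Exec 1 S (update S k (S k).tail) :=
  ⟨1, le_rfl, .loop_exit h⟩

theorem Exec.loop_step {k : K} {exit : Option (Γ k) → Bool} {f : Option (Γ k) → StackProg Γ}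
    (h : exit (S k).head? = false) (h₁ : (f (S k).head?).Exec B₁ (update S k (S k).tail) S₁)
    (h₂ : (loop k exit f).Exec B₂ S₁ S') : (loop k exit f).Exec (B₁ + B₂ + 1) S S' := by
  obtain ⟨t₁, ht₁, hr₁⟩ := h₁
  obtain ⟨t₂, ht₂, hr₂⟩ := h₂
  exact ⟨_, by omega, .loop_step h hr₁ hr₂⟩

end General

/-- Change the bound and the form of the result. -/
theorem Exec.to {p : StackProg (Alphabet Δ)} {S : ∀ k, List (Alphabet Δ k)}
    (h : p.Exec B S (mem a o w)) (hB : B ≤ B₁) (hw : w = w') : p.Exec B₁ S (mem a o w') :=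
  hw ▸ h.mono hB

/-- Push a bit. -/
def pushBit (i : BitStack) (b : Bool) : StackProg (Alphabet Δ) := push (Γ := Alphabet Δ) (.bits i) b

/-- Push a symbol on the input stack. -/
def pushInp (x : Γ') : StackProg (Alphabet Δ) := push (Γ := Alphabet Δ) .inp x

/-- Push a symbol on the output stack. -/
def pushOut (x : Δ) : StackProg (Alphabet Δ) := push (Γ := Alphabet Δ) .out x

/-- Pop a bit and use it. -/
def popBit (i : BitStack) (f : Bool → StackProg (Alphabet Δ)) : StackProg (Alphabet Δ) :=
  case (Γ := Alphabet Δ) (.bits i) fun b : Option Bool => f (b.getD false)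

/-- Pop all bits of a stack and use each. -/
def forBits (i : BitStack) (f : Bool → StackProg (Alphabet Δ)) : StackProg (Alphabet Δ) :=
  loop (Γ := Alphabet Δ) (.bits i) (fun b : Option Bool => b.isNone)
    fun b : Option Bool => f (b.getD false)

/-- Repeat a program for each bit `true` until a bit is `false`. -/
def forTrue (i : BitStack) (p : StackProg (Alphabet Δ)) : StackProg (Alphabet Δ) :=
  loop (Γ := Alphabet Δ) (.bits i) (fun b : Option Bool => !(b.getD false)) fun _ => p

/-- Read a row, using each bit. -/
def readRow (f : Bool → StackProg (Alphabet Δ)) : StackProg (Alphabet Δ) :=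
  loop (Γ := Alphabet Δ) .inp (fun x : Option Γ' => x == some .comma) fun
    | some (.bit b) => f b
    | _ => skip

/-- Read rows, using each bit and the end of each row. -/
def readRows (f : Bool → StackProg (Alphabet Δ)) (p : StackProg (Alphabet Δ)) :
    StackProg (Alphabet Δ) :=
  loop (Γ := Alphabet Δ) .inp (fun x : Option Γ' => x == some .ket) fun
    | some (.bit b) => f b
    | _ => p

/-! ### Running times of the basic programs -/

theorem Exec.pushBit (b : Bool) {l : List Bool} (hw : w i = l) :
    (pushBit i b).Exec 1 (mem a o w) (mem a o (update w i (b :: l))) := by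
  subst hw
  rw [← update_mem_bits]
  exact ⟨1, le_rfl, .push (Γ := Alphabet Δ) (.bits i) b _⟩

theorem Exec.pushInp (x : Γ') : (pushInp x).Exec 1 (mem a o w) (mem (x :: a) o w) := by
  have h := update_mem_inp (a := a) (o := o) (w := w) (x :: a)
  exact h ▸ ⟨1, le_rfl, .push (Γ := Alphabet Δ) .inp x _⟩

theorem Exec.pushOut (x : Δ) : (pushOut x).Exec 1 (mem a o w) (mem a (x :: o) w) := by
  have h := update_mem_out (a := a) (o := o) (w := w) (x :: o)
  exact h ▸ ⟨1, le_rfl, .push (Γ := Alphabet Δ) .out x _⟩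

theorem Exec.popBit {f : Bool → StackProg (Alphabet Δ)} {S' : ∀ k, List (Alphabet Δ k)}
    {b : Bool} {l : List Bool} (hw : w i = b :: l)
    (h : (f b).Exec B (mem a o (update w i l)) S') : (popBit i f).Exec (B + 1) (mem a o w) S' := by
  obtain ⟨t, ht, hr⟩ := h
  refine ⟨t + 1, by omega, ?_⟩
  apply Run.case
  change (f (((w i).head?).getD false)).Run (update (mem a o w) (.bits i) (w i).tail) t S'
  rw [update_mem_bits, hw]
  exact hr

theorem Exec.forBits_nil {f : Bool → StackProg (Alphabet Δ)} (hw : w i = []) :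
    (forBits i f).Exec 1 (mem a o w) (mem a o w) := by
  have h : (forBits i f).Exec 1 (mem a o w) (update (mem a o w) (.bits i) (w i).tail) :=
    Exec.loop_exit (S := mem a o w) (by change (w i).head?.isNone = true; rw [hw]; rfl)
  rwa [update_mem_bits, hw, List.tail_nil, ← hw, update_eq_self] at h

theorem Exec.forBits_cons {f : Bool → StackProg (Alphabet Δ)} {S₁ S' : ∀ k, List (Alphabet Δ k)}
    {b : Bool} {l : List Bool} (hw : w i = b :: l)
    (h₁ : (f b).Exec B₁ (mem a o (update w i l)) S₁) (h₂ : (forBits i f).Exec B₂ S₁ S') :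
    (forBits i f).Exec (B₁ + B₂ + 1) (mem a o w) S' := by
  refine Exec.loop_step (S := mem a o w) ?_ ?_ h₂
  · change (w i).head?.isNone = false
    rw [hw]
    rfl
  · change (f (((w i).head?).getD false)).Exec _ (update (mem a o w) (.bits i) (w i).tail) _
    rw [update_mem_bits, hw]
    exact h₁

/-- A loop of `m` rounds, with the state `M r` after the round `r`. -/
theorem Exec.forBits_counter {f : Bool → StackProg (Alphabet Δ)} (m : ℕ)
    (M : ℕ → BitStack → List Bool) (hM : ∀ r ≤ m, M r i = List.replicate (m - r) true)
    (h : ∀ r < m, (f true).Exec B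
      (mem a o (update (M r) i (List.replicate (m - (r + 1)) true))) (mem a o (M (r + 1)))) :
    (forBits i f).Exec (m * (B + 1) + 1) (mem a o (M 0)) (mem a o (M m)) := by
  have key : ∀ s r, r + s = m →
      (forBits i f).Exec (s * (B + 1) + 1) (mem a o (M r)) (mem a o (M m)) := by
    intro s
    induction s with
    | zero =>
      rintro r rfl
      refine (Exec.forBits_nil ?_).mono (by omega)
      simpa using hM r le_rfl
    | succ s ih =>
      intro r hr
      refine (Exec.forBits_cons (b := true) (l := List.replicate (m - (r + 1)) true) ?_
        (h r (by omega)) (ih (r + 1) (by omega))).mono (by ring_nf; omega)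
      rw [hM r (by omega), show m - r = m - (r + 1) + 1 by omega, List.replicate_succ]
  exact key m 0 (by omega)

theorem Exec.forTrue_exit {p : StackProg (Alphabet Δ)} {l : List Bool} (hw : w i = false :: l) :
    (forTrue i p).Exec 1 (mem a o w) (mem a o (update w i l)) := by
  have h : (forTrue i p).Exec 1 (mem a o w) (update (mem a o w) (.bits i) (w i).tail) :=
    Exec.loop_exit (S := mem a o w)
      (by change (!(w i).head?.getD false) = true; rw [hw]; rfl)
  rwa [update_mem_bits, hw] at h

theorem Exec.forTrue_step {p : StackProg (Alphabet Δ)} {S₁ S' : ∀ k, List (Alphabet Δ k)}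
    {l : List Bool} (hw : w i = true :: l)
    (h₁ : p.Exec B₁ (mem a o (update w i l)) S₁) (h₂ : (forTrue i p).Exec B₂ S₁ S') :
    (forTrue i p).Exec (B₁ + B₂ + 1) (mem a o w) S' := by
  refine Exec.loop_step (S := mem a o w) ?_ ?_ h₂
  · change (!(w i).head?.getD false) = false
    rw [hw]
    rfl
  · change p.Exec _ (update (mem a o w) (.bits i) (w i).tail) _
    rw [update_mem_bits, hw]
    exact h₁

theorem Exec.readRow_exit {f : Bool → StackProg (Alphabet Δ)} :
    (readRow f).Exec 1 (mem (.comma :: a) o w) (mem a o w) := by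
  have h : (readRow f).Exec 1 (mem (.comma :: a) o w) (update (mem (.comma :: a) o w) .inp a) :=
    Exec.loop_exit (S := mem (.comma :: a) o w) rfl
  rwa [update_mem_inp] at h

theorem Exec.readRow_step {f : Bool → StackProg (Alphabet Δ)} {b : Bool}
    {S₁ S' : ∀ k, List (Alphabet Δ k)} (h₁ : (f b).Exec B₁ (mem a o w) S₁)
    (h₂ : (readRow f).Exec B₂ S₁ S') :
    (readRow f).Exec (B₁ + B₂ + 1) (mem (.bit b :: a) o w) S' := by
  refine Exec.loop_step (S := mem (.bit b :: a) o w) rfl ?_ h₂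
  change (f b).Exec _ (update (mem (.bit b :: a) o w) .inp a) _
  rwa [update_mem_inp]

theorem Exec.readRows_exit {f : Bool → StackProg (Alphabet Δ)} {p : StackProg (Alphabet Δ)} :
    (readRows f p).Exec 1 (mem (.ket :: a) o w) (mem a o w) := by
  have h : (readRows f p).Exec 1 (mem (.ket :: a) o w) (update (mem (.ket :: a) o w) .inp a) :=
    Exec.loop_exit (S := mem (.ket :: a) o w) rfl
  rwa [update_mem_inp] at h

theorem Exec.readRows_bit {f : Bool → StackProg (Alphabet Δ)} {p : StackProg (Alphabet Δ)} {b : Bool}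
    {S₁ S' : ∀ k, List (Alphabet Δ k)} (h₁ : (f b).Exec B₁ (mem a o w) S₁)
    (h₂ : (readRows f p).Exec B₂ S₁ S') :
    (readRows f p).Exec (B₁ + B₂ + 1) (mem (.bit b :: a) o w) S' := by
  refine Exec.loop_step (S := mem (.bit b :: a) o w) rfl ?_ h₂
  change (f b).Exec _ (update (mem (.bit b :: a) o w) .inp a) _
  rwa [update_mem_inp]

theorem Exec.readRows_comma {f : Bool → StackProg (Alphabet Δ)} {p : StackProg (Alphabet Δ)}
    {S₁ S' : ∀ k, List (Alphabet Δ k)} (h₁ : p.Exec B₁ (mem a o w) S₁)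
    (h₂ : (readRows f p).Exec B₂ S₁ S') :
    (readRows f p).Exec (B₁ + B₂ + 1) (mem (.comma :: a) o w) S' := by
  refine Exec.loop_step (S := mem (.comma :: a) o w) rfl ?_ h₂
  change p.Exec _ (update (mem (.comma :: a) o w) .inp a) _
  rwa [update_mem_inp]

/-- Move the bits of a stack, one by one, to another one. -/
def move (i j : BitStack) : StackProg (Alphabet Δ) := forBits i (pushBit j)

/-- Moving reverses the order. A stack that is consumed while its bits are pushed on a primed stack
is thus restored by one move back. -/
theorem Exec.move (hij : i ≠ j) {l l' : List Bool} (hl : w i = l) (hl' : w j = l') :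
    (move i j).Exec (2 * l.length + 1) (mem a o w)
      (mem a o (update (update w i []) j (l.reverse ++ l'))) := by
  induction l generalizing w l' with
  | nil =>
    refine (Exec.forBits_nil hl).to le_rfl ?_
    rw [show update w i [] = w by rw [← hl, update_eq_self]]
    simp [← hl']
  | cons b l ih =>
    refine (Exec.forBits_cons hl (.pushBit b (l := l') (by simp [hij.symm, hl']))
      (ih (l' := b :: l') (by simp [hij]) (by simp))).to (by simp only [List.length_cons]; omega) ?_
    funext k
    simp only [update_apply]
    split_ifs <;> simp_all

/-- Remove the bits of a stack. -/
def clear (i : BitStack) : StackProg (Alphabet Δ) := forBits i fun _ => skip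

theorem Exec.clear {l : List Bool} (hl : w i = l) : (clear i).Exec (2 * l.length + 1) (mem a o w)
    (mem a o (update w i [])) := by
  induction l generalizing w with
  | nil =>
    refine (Exec.forBits_nil hl).to le_rfl ?_
    rw [← hl, update_eq_self]
  | cons b l ih =>
    refine (Exec.forBits_cons hl .skip (ih (by simp))).to
      (by simp only [List.length_cons]; omega) ?_
    simp

end StackProg

/-! ## One step of the computation of a level -/

/-- Some entry of the row `r` is an entry of `xs`. -/
def rowAny (r xs : List Bool) : Bool := (r.zip xs).any fun p => p.1 && p.2

/-- Each entry of the row `r` is an entry of `xs`. -/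
def rowAll (r xs : List Bool) : Bool := (r.zip xs).all fun p => !p.1 || p.2

/-- The version of `stepSet` for lists of bits. -/
def stepRows (xs : List Bool) : List (List Bool) → List Bool → List Bool → List Bool
  | r :: rs, d :: ds, p :: ps => (d || (rowAny r xs && (p || rowAll r xs))) :: stepRows xs rs ds ps
  | _, _, _ => []

namespace StackProg

variable {Δ : Type} {a : List Γ'} {o : List Δ} {w : BitStack → List Bool}

/-- Update the flags in `acc` and `flag` for an edge `e` to a vertex `b`. -/
def scanBit : Bool → Bool → StackProg (Alphabet Δ)
  | true, true => popBit .acc fun _ => pushBit .acc true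
  | true, false => popBit .flag fun _ => pushBit .flag false
  | false, _ => skip

theorem Exec.scanBit {e b x y : Bool} {l l' : List Bool} (ha : w .acc = x :: l)
    (hf : w .flag = y :: l') : (scanBit e b).Exec 2 (mem a o w)
      (mem a o (update (update w .acc ((x || (e && b)) :: l)) .flag ((y && (!e || b)) :: l'))) := by
  cases e
  · refine Exec.skip.to (by omega) ?_
    funext k
    cases k <;> simp [ha, hf]
  · cases b
    · refine (Exec.popBit (f := fun _ => StackProg.pushBit .flag false) hf (.pushBit false (update_self ..))).to le_rfl ?_
      funext k
      cases k <;> simp [ha]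
    · refine (Exec.popBit (f := fun _ => StackProg.pushBit .acc true) ha (.pushBit true (update_self ..))).to le_rfl ?_
      funext k
      cases k <;> simp [hf]

/-- Compare the next edge with a bit of `reach`. -/
def scanEdge (b : Bool) : StackProg (Alphabet Δ) :=
  (pushBit .reach' b).seq <| popBit .edges fun e => (pushBit .edges' e).seq <| scanBit e b

/-- Compare a row of edges with the vertices in `reach`. -/
def scanRow : StackProg (Alphabet Δ) := forBits .reach scanEdge

/-- Only the top bits of `acc` and `flag` are used, as accumulators of a disjunction and a
conjunction. Below its top, `acc` keeps the results for earlier vertices, and `rest` holds the rows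
of later ones. -/
theorem Exec.scanRow {xs xs' r r' rest acc fl : List Bool} {x y : Bool} (hx : w .reach = xs)
    (hx' : w .reach' = xs') (hr : w .edges = r ++ rest) (hr' : w .edges' = r')
    (hl : r.length = xs.length) (ha : w .acc = x :: acc) (hf : w .flag = y :: fl) :
    scanRow.Exec (6 * xs.length + 1) (mem a o w)
      (mem a o (update (update (update (update (update (update w .reach [])
        .reach' (xs.reverse ++ xs')) .edges rest) .edges' (r.reverse ++ r'))
        .acc ((x || rowAny r xs) :: acc)) .flag ((y && rowAll r xs) :: fl))) := by
  induction xs generalizing w r r' xs' x y with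
  | nil =>
    refine (Exec.forBits_nil hx).to (by simp) ?_
    obtain rfl : r = [] := by simpa using hl
    funext k
    cases k <;> simp [hx, hx', hr, hr', ha, hf, rowAny, rowAll]
  | cons b xs ih =>
    obtain _ | ⟨e, r⟩ := r
    · simp at hl
    have hl' : r.length = xs.length := by simpa using hl
    have h1 : ∀ w : BitStack → List Bool, w .reach' = xs' → w .edges = e :: (r ++ rest) →
        w .edges' = r' → w .acc = x :: acc → w .flag = y :: fl →
        (scanEdge (Δ := Δ) b).Exec 5 (mem a o w)
        (mem a o (update (update (update (update (update w .reach' (b :: xs')) .edges (r ++ rest))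
          .edges' (e :: r')) .acc ((x || (e && b)) :: acc)) .flag ((y && (!e || b)) :: fl))) := by
      intro w h1 h2 h3 h4 h5
      refine .mono (.seq (.pushBit b h1) (.popBit (b := e) (l := r ++ rest) ?_
        (.seq (.pushBit e (l := r') ?_) (.scanBit ?_ ?_)))) le_rfl <;> simp [*]
    refine (Exec.forBits_cons hx (h1 _ ?_ ?_ ?_ ?_ ?_) (ih (r := r) (r' := e :: r')
      (xs' := b :: xs') (x := x || (e && b)) (y := y && (!e || b)) ?_ ?_ ?_ ?_ hl' ?_ ?_)).to ?_ ?_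
    all_goals try simp [*]
    · omega
    · funext k
      cases k <;> simp [rowAny, rowAll, Bool.or_assoc, Bool.and_assoc]

/-- The treatment of one vertex in `stepLoop`. -/
def stepVertex (p : BitStack) (bd : Bool) : StackProg (Alphabet Δ) :=
  (pushBit .base' bd).seq <| popBit p fun bp => (pushBit .owned' bp).seq <|
    -- The initial flags are the neutral elements of disjunction and conjunction.
    (pushBit .acc false).seq <| (pushBit .flag true).seq <| scanRow.seq <| (move .reach' .reach).seq <|
      popBit .flag fun y => popBit .acc fun x => pushBit .acc (bd || (x && (bp || y)))

theorem Exec.stepVertex {p : BitStack} (hp : p = .owned ∨ p = .ones) {bd bp : Bool}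
    {xs ps ds' ps' r r' rest acc : List Bool} (hx : w .reach = xs)
    (hx' : w .reach' = []) (hpw : w p = bp :: ps) (hr : w .edges = r ++ rest) (hr' : w .edges' = r')
    (hd' : w .base' = ds') (hp' : w .owned' = ps') (ha : w .acc = acc) (hf : w .flag = [])
    (hl : r.length = xs.length) :
    (stepVertex p bd).Exec (8 * xs.length + 10) (mem a o w)
      (mem a o (update (update (update (update (update (update w p ps) .base' (bd :: ds'))
        .owned' (bp :: ps')) .edges rest) .edges' (r.reverse ++ r'))
        .acc ((bd || (rowAny r xs && (bp || rowAll r xs))) :: acc))) := by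
  refine Exec.to (B := 1 + (1 + (1 + (1 + (6 * xs.length + 1 + (2 * xs.length + 1 + (1 + 1 + 1))))) + 1))
    (.seq (.pushBit bd hd') (.popBit (b := bp) (l := ps) ?_ (.seq (.pushBit bp (l := ps') ?_)
    (.seq (.pushBit false (l := acc) ?_) (.seq (.pushBit true (l := []) ?_)
    (.seq (.scanRow (xs := xs) (xs' := []) (r := r) (r' := r') (rest := rest) (x := false) (y := true)
      (acc := acc) (fl := []) ?_ ?_ ?_ ?_ hl ?_ ?_) (.mono (B := 2 * xs.reverse.length + 1 + (1 + 1 + 1))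
      (.seq (.move (by decide) (l := xs.reverse) (l' := []) ?_ ?_)
      (Exec.popBit (f := fun y => StackProg.popBit .acc fun x =>
          StackProg.pushBit .acc (bd || (x && (bp || y))))
        (b := rowAll r xs) (l := []) ?_
      (Exec.popBit (f := fun x => StackProg.pushBit .acc (bd || (x && (bp || rowAll r xs))))
        (b := rowAny r xs) (l := acc) ?_ (.pushBit _ (l := acc) ?_)))) ?_))))))) ?_ ?_
  all_goals try (rcases hp with rfl | rfl <;> simp [*]; done)
  · omega
  · funext k
    rcases hp with rfl | rfl <;> cases k <;> simp [*]

/-- Treat all vertices: the loop of `assignStep`. -/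
def stepLoop (d p : BitStack) : StackProg (Alphabet Δ) := forBits d (stepVertex p)

theorem Exec.stepLoop {d p : BitStack} (hd : d = .target ∨ d = .base) (hp : p = .owned ∨ p = .ones)
    {xs ds ps ds' ps' r' acc : List Bool} {rs : List (List Bool)} {n : ℕ} (hx : w .reach = xs)
    (hx' : w .reach' = []) (hdw : w d = ds) (hpw : w p = ps) (hr : w .edges = rs.flatten)
    (hr' : w .edges' = r') (hd' : w .base' = ds') (hp' : w .owned' = ps') (ha : w .acc = acc)
    (hf : w .flag = [])
    (hn : xs.length = n) (hrn : ∀ r ∈ rs, r.length = n) (hds : ds.length = rs.length)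
    (hps : ps.length = rs.length) :
    (stepLoop d p).Exec (rs.length * (8 * n + 11) + 1) (mem a o w)
      (mem a o (update (update (update (update (update (update (update w d [])
        p []) .base' (ds.reverse ++ ds')) .owned' (ps.reverse ++ ps'))
        .edges []) .edges' (rs.flatten.reverse ++ r'))
        .acc ((stepRows xs rs ds ps).reverse ++ acc))) := by
  induction rs generalizing w ds ps ds' ps' r' acc with
  | nil =>
    obtain rfl : ds = [] := by simpa using hds
    obtain rfl : ps = [] := by simpa using hps
    refine (Exec.forBits_nil hdw).to (by simp) ?_
    funext k
    rcases hd with rfl | rfl <;> rcases hp with rfl | rfl <;>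
      cases k <;> simp [*, stepRows]
  | cons r rs ih =>
    obtain _ | ⟨bd, ds⟩ := ds
    · simp at hds
    obtain _ | ⟨bp, ps⟩ := ps
    · simp at hps
    have hrn' : r.length = xs.length := by rw [hn]; exact hrn r (by simp)
    have hds' : ds.length = rs.length := by simpa using hds
    have hps' : ps.length = rs.length := by simpa using hps
    refine (Exec.forBits_cons hdw (.stepVertex hp (bp := bp) (xs := xs) (ps := ps) (ds' := ds')
      (ps' := ps') (r := r) (r' := r') (rest := rs.flatten) (acc := acc)
        ?_ ?_ ?_ ?_ ?_ ?_ ?_ ?_ ?_ hrn') (ih (ds := ds) (ps := ps) (ds' := bd :: ds')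
        (ps' := bp :: ps') (r' := r.reverse ++ r')
        (acc := (bd || (rowAny r xs && (bp || rowAll r xs))) :: acc)
        ?_ ?_ ?_ ?_ ?_ ?_ ?_ ?_ ?_ ?_ (fun r h => hrn r (by simp [h])) hds' hps')).to ?_ ?_
    all_goals try (rcases hd with rfl | rfl <;> rcases hp with rfl | rfl <;> simp [*]; done)
    · rw [hn, List.length_cons]
      ring_nf
      omega
    · funext k
      rcases hd with rfl | rfl <;> rcases hp with rfl | rfl <;>
        cases k <;> simp [*, stepRows]

end StackProg

/-! ## The table of costs -/

theorem stepRows_length {xs : List Bool} {rs : List (List Bool)} {ds ps : List Bool}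
    (hd : ds.length = rs.length) (hp : ps.length = rs.length) :
    (stepRows xs rs ds ps).length = rs.length := by
  induction rs generalizing ds ps with
  | nil => simp [stepRows]
  | cons r rs ih =>
    obtain _ | ⟨d, ds⟩ := ds
    · simp at hd
    obtain _ | ⟨p, ps⟩ := ps
    · simp at hp
    simp only [stepRows, List.length_cons]
    rw [ih (by simpa using hd) (by simpa using hp)]

theorem bitsOf_eq_ofFn {n : ℕ} {s : Fin n → Prop} {f : Fin n → Bool} (h : ∀ i, f i = true ↔ s i) :
    List.ofFn f = bitsOf s := by
  classical
  unfold bitsOf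
  congr 1
  funext i
  rw [Bool.eq_iff_iff, h, decide_eq_true_iff]

theorem rowAny_bitsOf {n : ℕ} {r x : Fin n → Prop} :
    rowAny (bitsOf r) (bitsOf x) = true ↔ ∃ i, r i ∧ x i := by
  unfold bitsOf rowAny
  induction n with
  | zero => simp
  | succ n ih =>
    rw [List.ofFn_succ, List.ofFn_succ, List.zip_cons_cons, List.any_cons, Bool.or_eq_true, ih,
      Fin.exists_fin_succ]
    simp

theorem rowAll_bitsOf {n : ℕ} {r x : Fin n → Prop} :
    rowAll (bitsOf r) (bitsOf x) = true ↔ ∀ i, r i → x i := by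
  unfold bitsOf rowAll
  induction n with
  | zero => simp
  | succ n ih =>
    rw [List.ofFn_succ, List.ofFn_succ, List.zip_cons_cons, List.all_cons, Bool.and_eq_true, ih,
      Fin.forall_fin_succ]
    simp [imp_iff_not_or]

theorem stepRows_ofFn {n : ℕ} (xs : List Bool) (r : Fin n → List Bool) (d p : Fin n → Bool) :
    stepRows xs (List.ofFn r) (List.ofFn d) (List.ofFn p) =
      List.ofFn fun i => d i || (rowAny (r i) xs && (p i || rowAll (r i) xs)) := by
  induction n with
  | zero => simp [stepRows]
  | succ n ih => simp [List.ofFn_succ, stepRows, ih]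

/-- The rows of the adjacency matrix. -/
noncomputable def edgeRows {n : ℕ} (E : Fin n → Fin n → Prop) : List (List Bool) :=
  List.ofFn fun u => bitsOf (E u)

theorem stepRows_bitsOf {n : ℕ} (E : Fin n → Fin n → Prop) (D P X : Set (Fin n)) :
    stepRows (bitsOf (· ∈ X)) (edgeRows E) (bitsOf (· ∈ D)) (bitsOf (· ∈ P)) =
      bitsOf (· ∈ stepSet E D P X) := by
  rw [edgeRows, bitsOf, bitsOf, bitsOf, stepRows_ofFn]
  refine bitsOf_eq_ofFn fun i => ?_
  simp only [Bool.or_eq_true, Bool.and_eq_true, decide_eq_true_iff]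
  rw [← bitsOf, rowAny_bitsOf, rowAll_bitsOf]
  rfl

theorem bitsOf_univ {n : ℕ} : bitsOf (· ∈ (Set.univ : Set (Fin n))) = List.replicate n true := by
  simp [bitsOf]

theorem bitsOf_empty {n : ℕ} : bitsOf (· ∈ (∅ : Set (Fin n))) = List.replicate n false := by
  simp [bitsOf]

theorem length_edgeRows_flatten {n : ℕ} (E : Fin n → Fin n → Prop) :
    (edgeRows E).flatten.length = n * n := by
  simp [edgeRows, List.length_flatten, List.map_ofFn, Function.comp_def, bitsOf_length]

/-- A list of numbers, each in unary and closed by a zero. -/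
def unaryList (l : List ℕ) : List Bool := l.flatMap fun m => List.replicate m true ++ [false]

theorem unaryList_cons (m : ℕ) (l : List ℕ) :
    unaryList (m :: l) = List.replicate m true ++ false :: unaryList l := by
  simp [unaryList]

theorem length_unaryList_le {l : List ℕ} {M : ℕ} (h : ∀ m ∈ l, m ≤ M) :
    (unaryList l).length ≤ l.length * (M + 1) := by
  induction l with
  | nil => simp [unaryList]
  | cons m l ih =>
    have h1 := h m (by simp)
    have h2 := ih fun m hm => h m (by simp [hm])
    simp only [unaryList_cons, List.length_append, List.length_replicate, List.length_cons]
    ring_nf at *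
    omega

/-- The number of levels before the level `r` with which Player 1 does not win from `u`. -/
noncomputable def lossCount {n : ℕ} (E : Fin n → Fin n → Prop) (T P : Set (Fin n)) :
    ℕ → Fin n → ℕ
  | 0, _ => 0
  | r + 1, u => open Classical in
      lossCount E T P r u + if u ∈ stepSet E T P (level E T P (r + 1)) then 0 else 1

theorem lossCount_le {n : ℕ} {E : Fin n → Fin n → Prop} {T P : Set (Fin n)} (r : ℕ) (u : Fin n) :
    lossCount E T P r u ≤ r := by
  induction r with
  | zero => rfl
  | succ r ih =>
    rw [lossCount]
    split_ifs <;> omega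

namespace StackProg

variable {Δ : Type} {a : List Γ'} {o : List Δ} {w : BitStack → List Bool}

/-- Set the stack `dst` to the result of a step. -/
def assignStep (d p dst : BitStack) : StackProg (Alphabet Δ) :=
  (stepLoop d p).seq <| (move .base' d).seq <| (move .owned' p).seq <| (move .edges' .edges).seq <|
    (clear dst).seq (move .acc dst)

/-- The three admissible choices of stacks are the ones that occur: the base of a new level (with
`ones` as the full set), one iteration within a level, and the test for winning at the initial
configuration. All sources except the overwritten stack are restored. -/
theorem Exec.assignStep {d p dst : BitStack}
    (h : (d = .target ∧ p = .ones ∧ dst = .base) ∨ (d = .base ∧ p = .owned ∧ dst = .reach) ∨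
      (d = .target ∧ p = .owned ∧ dst = .won)) {n : ℕ} {E : Fin n → Fin n → Prop}
    {D P X : Set (Fin n)} {l : List Bool} (hx : w .reach = bitsOf (· ∈ X)) (hdw : w d = bitsOf (· ∈ D))
    (hpw : w p = bitsOf (· ∈ P)) (hr : w .edges = (edgeRows E).flatten)
    (hdst : w dst = l) (hl : l.length ≤ n)
    (h' : ∀ i ∈ [BitStack.reach', .edges', .base', .owned', .acc, .flag], w i = []) :
    (assignStep d p dst).Exec (20 * (n + 1) ^ 2) (mem a o w)
      (mem a o (update w dst (bitsOf (· ∈ stepSet E D P X)))) := by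
  simp only [List.forall_mem_cons, List.not_mem_nil, false_imp_iff, implies_true, and_true] at h'
  obtain ⟨h1, h2, h3, h4, h5, h6⟩ := h'
  have hlen := stepRows_bitsOf E D P X
  generalize hds : bitsOf (· ∈ D) = ds at *
  generalize hps : bitsOf (· ∈ P) = ps at *
  generalize hxs : bitsOf (· ∈ X) = xs at *
  generalize bitsOf (· ∈ stepSet E D P X) = ys at *
  have nds : ds.length = n := hds ▸ bitsOf_length _
  have nps : ps.length = n := hps ▸ bitsOf_length _
  have nxs : xs.length = n := hxs ▸ bitsOf_length _
  have nrs : (edgeRows E).length = n := by simp [edgeRows]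
  have ne := length_edgeRows_flatten E
  have nys : ys.length = n := by
    rw [← hlen, stepRows_length (nds.trans nrs.symm) (nps.trans nrs.symm), nrs]
  refine Exec.to (B := (edgeRows E).length * (8 * n + 11) + 1 + (2 * ds.reverse.length + 1 +
    (2 * ps.reverse.length + 1 + (2 * (edgeRows E).flatten.reverse.length + 1 +
    (2 * l.length + 1 + (2 * ys.reverse.length + 1))))))
    (.seq (.stepLoop (xs := xs) (ds := ds) (ps := ps) (rs := edgeRows E) (n := n)
    (ds' := []) (ps' := []) (r' := []) (acc := [])
    ?_ ?_ hx h1 hdw hpw hr h2 h3 h4 h5 h6 nxs ?_ (nds.trans nrs.symm) (nps.trans nrs.symm))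
    (.seq (.move (l := ds.reverse) (l' := []) ?_ ?_ ?_) (.seq
    (.move (l := ps.reverse) (l' := []) ?_ ?_ ?_) (.seq
    (.move (l := (edgeRows E).flatten.reverse) (l' := []) ?_ ?_ ?_) (.seq (.clear (l := l) ?_)
    (.move (l := ys.reverse) (l' := []) ?_ ?_ ?_)))))) ?_ ?_
  · tauto
  · tauto
  · simp [edgeRows, bitsOf_length]
  all_goals try (rcases h with ⟨rfl, rfl, rfl⟩ | ⟨rfl, rfl, rfl⟩ | ⟨rfl, rfl, rfl⟩ <;> simp [*]; done)
  · rcases h with ⟨rfl, rfl, rfl⟩ | ⟨rfl, rfl, rfl⟩ | ⟨rfl, rfl, rfl⟩ <;> simpa using hdst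
  · simp only [List.length_reverse, nds, nps, nrs, ne, nys]
    nlinarith
  · funext k
    rcases h with ⟨rfl, rfl, rfl⟩ | ⟨rfl, rfl, rfl⟩ | ⟨rfl, rfl, rfl⟩ <;> cases k <;> simp [*]

/-- Append one to the unary number on `table`, unless `c`, and move it to `table'`. -/
def addUnless (c : Bool) : StackProg (Alphabet Δ) :=
  (forTrue .table (pushBit .table' true)).seq <|
    (if c then skip else pushBit .table' true).seq (pushBit .table' false)

theorem Exec.forTrue_pushBit {m : ℕ} {l l' : List Bool}
    (hw : w .table = List.replicate m true ++ false :: l) (hw' : w .table' = l') :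
    (forTrue .table (StackProg.pushBit .table' true)).Exec (2 * m + 1) (mem a o w)
      (mem a o (update (update w .table l) .table' (List.replicate m true ++ l'))) := by
  induction m generalizing w l' with
  | zero =>
    refine (Exec.forTrue_exit (l := l) (by simpa using hw)).to (by omega) ?_
    funext k
    cases k <;> simp [hw']
  | succ m ih =>
    refine (Exec.forTrue_step (l := List.replicate m true ++ false :: l)
      (by simpa [List.replicate_succ] using hw) (.pushBit true (l := l') (by simpa using hw'))
      (ih (l' := true :: l') (by simp) (by simp))).to (by omega) ?_
    funext k
    cases k <;> simp [List.replicate_succ']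

theorem Exec.addUnless {c : Bool} {m : ℕ} {l l' : List Bool}
    (hw : w .table = List.replicate m true ++ false :: l) (hw' : w .table' = l') :
    (addUnless c).Exec (2 * m + 3) (mem a o w)
      (mem a o (update (update w .table l) .table'
        (false :: (List.replicate (m + if c then 0 else 1) true ++ l')))) := by
  cases c
  · refine (Exec.seq (.forTrue_pushBit hw hw') (.seq (.pushBit true (update_self ..))
      (.pushBit false (update_self ..)))).to (by omega) ?_
    funext k
    cases k <;> simp [List.replicate_succ]
  · refine (Exec.seq (.forTrue_pushBit hw hw') (.seq .skip
      (.pushBit false (update_self ..)))).to (by omega) ?_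
    funext k
    cases k <;> simp

/-- Add one to the numbers of the table at the vertices that are not in `won`. -/
def addWon : StackProg (Alphabet Δ) := (forBits .won addUnless).seq (move .table' .table)

/-- An entry is pushed with its ones first and its closing zero last, so the new table appears
reversed as a bit string; the final move in `addWon` puts it right. -/
theorem Exec.forBits_addUnless {cs l' : List Bool} {ms : List ℕ} {M : ℕ} (hM : ∀ m ∈ ms, m ≤ M)
    (hl : cs.length = ms.length) (hc : w .won = cs) (hw : w .table = unaryList ms)
    (hw' : w .table' = l') :
    (forBits .won StackProg.addUnless).Exec (ms.length * (2 * M + 4) + 1) (mem a o w)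
      (mem a o (update (update (update w .won []) .table []) .table'
        ((unaryList (List.zipWith (fun c m => m + if c then 0 else 1) cs ms)).reverse ++ l'))) := by
  induction cs generalizing w ms l' with
  | nil =>
    obtain rfl : ms = [] := by simpa using hl.symm
    refine (Exec.forBits_nil hc).to (by simp) ?_
    funext k
    cases k <;> simp [unaryList, *]
  | cons c cs ih =>
    obtain _ | ⟨m, ms⟩ := ms
    · simp at hl
    have hm := hM m (by simp)
    refine (Exec.forBits_cons hc (.addUnless (c := c) (m := m) (l := unaryList ms) (l' := l') ?_ ?_)
      (ih (ms := ms)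
        (l' := false :: (List.replicate (m + if c = true then 0 else 1) true ++ l'))
        (fun m h => hM m (by simp [h])) (by simpa using hl) ?_ ?_ ?_)).to ?_ ?_
    · simpa [unaryList_cons] using hw
    · simpa using hw'
    · simp
    · simp
    · simp
    · rw [List.length_cons]
      ring_nf
      omega
    · funext k
      cases k <;> simp [unaryList_cons]

theorem Exec.addWon {cs : List Bool} {ms : List ℕ} {M : ℕ} (hM : ∀ m ∈ ms, m ≤ M)
    (hl : cs.length = ms.length) (hc : w .won = cs) (hw : w .table = unaryList ms)
    (hw' : w .table' = []) :
    addWon.Exec (8 * (ms.length + 1) * (M + 2)) (mem a o w)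
      (mem a o (update (update w .won []) .table
        (unaryList (List.zipWith (fun c m => m + if c then 0 else 1) cs ms)))) := by
  have hlen : (unaryList (List.zipWith (fun c m => m + if c = true then 0 else 1) cs ms)).length ≤
      ms.length * (M + 2) := by
    have := length_unaryList_le (M := M + 1)
      (l := List.zipWith (fun c m => m + if c = true then 0 else 1) cs ms) ?_
    · simpa [hl] using this
    · intro m hm
      obtain ⟨c, x, hx, rfl⟩ : ∃ (c : Bool) (x : ℕ), x ∈ ms ∧ (x + if c = true then 0 else 1) = m := by
        rw [← List.map_uncurry_zip_eq_zipWith, List.mem_map] at hm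
        obtain ⟨⟨c, x⟩, hx, rfl⟩ := hm
        exact ⟨c, x, (List.of_mem_zip hx).2, rfl⟩
      have := hM x hx
      split_ifs <;> omega
  refine (Exec.seq (.forBits_addUnless hM hl hc hw hw') (.move (by decide) (l' := [])
    (update_self ..) (by simp))).to ?_ ?_
  · simp only [List.append_nil, List.length_reverse]
    nlinarith
  · funext k
    cases k <;> simp [hw']

end StackProg

/-! ### Levels, rounds and the program for the table -/

namespace StackProg

variable {Δ : Type} {a : List Γ'} {o : List Δ} {n : ℕ} {E : Fin n → Fin n → Prop}
  {T P X D : Set (Fin n)} {c tab rounds : List Bool}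

/-- The contents of the stacks during the computation of the table. -/
noncomputable def levelMem (E : Fin n → Fin n → Prop) (T P : Set (Fin n))
    (reach ones ones' base won table rounds : List Bool) : BitStack → List Bool
  | .edges => (edgeRows E).flatten
  | .target => bitsOf (· ∈ T)
  | .owned => bitsOf (· ∈ P)
  | .reach => reach
  | .ones => ones
  | .ones' => ones'
  | .base => base
  | .won => won
  | .table => table
  | .rounds => rounds
  | _ => []

/-- Repeat a step as often as there are vertices. -/
def levelLoop : StackProg (Alphabet Δ) :=
  (forBits .ones fun _ => (pushBit .ones' true).seq (assignStep .base .owned .reach)).seq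
    (move .ones' .ones)

/-- The stack `ones` serves as the loop counter, since within a level the controlled set is `owned`;
it is rebuilt from `ones'`. -/
theorem Exec.levelLoop : levelLoop.Exec (n * (20 * (n + 1) ^ 2 + 2) + 2 * n + 2)
    (mem a o (levelMem E T P (bitsOf (· ∈ X)) (.replicate n true) [] (bitsOf (· ∈ D)) c tab rounds))
    (mem a o (levelMem E T P (bitsOf (· ∈ (stepSet E D P)^[n] X)) (.replicate n true) []
      (bitsOf (· ∈ D)) c tab rounds)) := by
  let M : ℕ → BitStack → List Bool := fun r => levelMem E T P (bitsOf (· ∈ (stepSet E D P)^[r] X))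
    (.replicate (n - r) true) (.replicate r true) (bitsOf (· ∈ D)) c tab rounds
  have h1 : Exec _ (n * (1 + 20 * (n + 1) ^ 2 + 1) + 1) (mem a o (M 0)) (mem a o (M n)) :=
    Exec.forBits_counter (i := .ones)
    (f := fun _ => (StackProg.pushBit .ones' true).seq (StackProg.assignStep .base .owned .reach))
    n M (fun _ _ => rfl) (fun r hr => by
      refine (Exec.seq (.pushBit true (l := .replicate r true) ?_)
        (.assignStep (.inr (.inl ⟨rfl, rfl, rfl⟩)) (n := n) (E := E) (D := D) (P := P)
          (X := (stepSet E D P)^[r] X) (l := bitsOf (· ∈ (stepSet E D P)^[r] X))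
          ?_ ?_ ?_ ?_ ?_ ?_ ?_)).to le_rfl ?_
      · simp [M, levelMem]
      · simp [M, levelMem]
      · simp [M, levelMem]
      · simp [M, levelMem]
      · simp [M, levelMem]
      · simp [M, levelMem]
      · simp [bitsOf_length]
      · simp [M, levelMem]
      · funext k
        rw [← Function.iterate_succ_apply' (stepSet E D P)]
        cases k <;> simp [M, levelMem, List.replicate_succ])
  have e0 : M 0 = levelMem E T P (bitsOf (· ∈ X)) (.replicate n true) [] (bitsOf (· ∈ D)) c tab
    rounds := rfl
  rw [e0] at h1
  refine (h1.seq (.move (by decide) (l := .replicate n true) (l' := []) ?_ ?_)).to ?_ ?_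
  · simp [M, levelMem]
  · simp [M, levelMem]
  · simp only [List.length_replicate]
    ring_nf
    omega
  · funext k
    cases k <;> simp [M, levelMem]

/-- Compute a level, and update the table. -/
def levelRound : StackProg (Alphabet Δ) :=
  (assignStep .target .ones .base).seq <| levelLoop.seq <| (assignStep .target .owned .won).seq <|
    addWon.seq (clear .base)

theorem getElem_bitsOf {s : Fin n → Prop} {i : ℕ} (h : i < (bitsOf s).length) :
    (bitsOf s)[i] = true ↔ s ⟨i, by simpa [bitsOf_length] using h⟩ := by
  simp [bitsOf]

/-- The entrywise update performed by `addWon` is the recursion of `lossCount`. -/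
theorem zipWith_lossCount (r : ℕ) :
    List.zipWith (fun c m => m + if c = true then 0 else 1)
      (bitsOf (· ∈ stepSet E T P (level E T P (r + 1)))) (List.ofFn (lossCount E T P r)) =
      List.ofFn (lossCount E T P (r + 1)) := by
  refine List.ext_getElem (by simp [bitsOf_length]) fun i h1 h2 => ?_
  classical
  simp only [List.getElem_zipWith, List.getElem_ofFn, lossCount]
  exact congrArg _ (if_congr (getElem_bitsOf _) rfl rfl)

/-- The bound on `r` bounds the unary entries of the table, hence the time for updating it. -/
theorem Exec.levelRound {r : ℕ} (hr : r ≤ n) : levelRound.Exec (100 * (n + 1) ^ 3)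
    (mem a o (levelMem E T P (bitsOf (· ∈ level E T P r)) (.replicate n true) [] [] []
      (unaryList (List.ofFn (lossCount E T P r))) rounds))
    (mem a o (levelMem E T P (bitsOf (· ∈ level E T P (r + 1))) (.replicate n true) [] [] []
      (unaryList (List.ofFn (lossCount E T P (r + 1)))) rounds)) := by
  have h1 : (StackProg.assignStep .target .ones .base).Exec (20 * (n + 1) ^ 2)
      (mem a o (levelMem E T P (bitsOf (· ∈ level E T P r)) (.replicate n true) [] []
      [] (unaryList (List.ofFn (lossCount E T P r))) rounds))
      (mem a o (levelMem E T P (bitsOf (· ∈ level E T P r)) (.replicate n true) []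
      (bitsOf (· ∈ stepSet E T Set.univ (level E T P r))) []
      (unaryList (List.ofFn (lossCount E T P r))) rounds)) := by
    refine (Exec.assignStep (.inl ⟨rfl, rfl, rfl⟩) (n := n) (E := E) (D := T) (P := Set.univ)
      (X := level E T P r) (l := []) rfl rfl bitsOf_univ.symm rfl rfl (by simp) ?_).to le_rfl ?_
    · simp [levelMem]
    · funext k
      cases k <;> simp [levelMem]
  have h2 := Exec.levelLoop (Δ := Δ) (a := a) (o := o) (E := E) (T := T) (P := P)
    (X := level E T P r) (D := stepSet E T Set.univ (level E T P r)) (c := [])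
    (tab := unaryList (List.ofFn (lossCount E T P r))) (rounds := rounds)
  have e : (stepSet E (stepSet E T Set.univ (level E T P r)) P)^[n] (level E T P r) =
      level E T P (r + 1) := by rw [level, Nat.card_fin]
  rw [e] at h2
  refine (h1.seq (h2.seq (.seq (.assignStep (.inr (.inr ⟨rfl, rfl, rfl⟩)) (n := n) (E := E) (D := T)
    (P := P) (X := level E T P (r + 1)) (l := []) rfl rfl rfl rfl rfl (by simp) ?_)
    (.seq (.addWon (M := n) (cs := bitsOf (· ∈ stepSet E T P (level E T P (r + 1))))
      (ms := List.ofFn (lossCount E T P r)) ?_ ?_ ?_ ?_ ?_)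
    (.clear (l := bitsOf (· ∈ stepSet E T Set.univ (level E T P r))) ?_))))).to ?_ ?_
  · simp [levelMem]
  · intro m hm
    rw [List.mem_ofFn] at hm
    obtain ⟨u, rfl⟩ := hm
    exact (lossCount_le r u).trans hr
  · simp [bitsOf_length]
  · simp
  · simp [levelMem]
  · simp [levelMem]
  · simp [levelMem]
  · simp only [bitsOf_length, List.length_ofFn]
    ring_nf
    omega
  · rw [zipWith_lossCount]
    funext k
    cases k <;> simp [levelMem]

/-- Compute the table, and the set of the vertices with a finite entry. -/
def computeTable : StackProg (Alphabet Δ) :=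
  (forBits .rounds fun _ => levelRound).seq <| (assignStep .target .owned .won).seq <|
    (clear .edges).seq <| (clear .target).seq <| (clear .owned).seq <| (clear .ones).seq
      (clear .reach)

/-- The contents of the stacks after the computation of the table. -/
noncomputable def tableMem (E : Fin n → Fin n → Prop) (T P : Set (Fin n)) : BitStack → List Bool
  | .won => bitsOf (· ∈ stepSet E T P (level E T P n))
  | .table => unaryList (List.ofFn (lossCount E T P n))
  | _ => []

/-- After `n` rounds the levels are stable, so the last test finds the vertices with a finite
minimum. All other stacks are emptied, because a computation has to end with nothing but its output.
-/
theorem Exec.computeTable : computeTable.Exec (200 * (n + 1) ^ 4)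
    (mem a o (levelMem E T P (.replicate n false) (.replicate n true) [] [] []
      (.replicate n false) (.replicate n true))) (mem a o (tableMem E T P)) := by
  let M : ℕ → BitStack → List Bool := fun r => levelMem E T P (bitsOf (· ∈ level E T P r))
    (.replicate n true) [] [] [] (unaryList (List.ofFn (lossCount E T P r)))
    (.replicate (n - r) true)
  have h1 : Exec _ (n * (100 * (n + 1) ^ 3 + 1) + 1) (mem a o (M 0)) (mem a o (M n)) :=
    Exec.forBits_counter (i := .rounds) (f := fun _ => StackProg.levelRound) n M (fun _ _ => rfl)
      (fun r hr => by
        have e : update (M r) .rounds (List.replicate (n - (r + 1)) true) =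
            levelMem E T P (bitsOf (· ∈ level E T P r)) (.replicate n true) [] [] []
              (unaryList (List.ofFn (lossCount E T P r))) (.replicate (n - (r + 1)) true) := by
          funext k
          cases k <;> simp [M, levelMem]
        rw [e]
        exact Exec.levelRound hr.le)
  have e0 : M 0 = levelMem E T P (.replicate n false) (.replicate n true) [] [] []
      (.replicate n false) (.replicate n true) := by
    have : unaryList (List.replicate n 0) = .replicate n false := by
      generalize n = m
      induction m with
      | zero => rfl
      | succ m ih => rw [List.replicate_succ, unaryList_cons, ih]; rfl
    funext k
    cases k <;> simp [M, levelMem, level, lossCount, bitsOf, this]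
  rw [e0] at h1
  refine (h1.seq (.seq (.assignStep (.inr (.inr ⟨rfl, rfl, rfl⟩)) (n := n) (E := E) (D := T)
    (P := P) (X := level E T P n) (l := []) rfl rfl rfl rfl rfl (by simp) ?_)
    (.seq (.clear (l := (edgeRows E).flatten) ?_)
    (.seq (.clear (l := bitsOf (· ∈ T)) ?_) (.seq (.clear (l := bitsOf (· ∈ P)) ?_)
    (.seq (.clear (l := .replicate n true) ?_)
    (.clear (l := bitsOf (· ∈ level E T P n)) ?_))))))).to ?_ ?_
  · simp [M, levelMem]
  · simp [M, levelMem]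
  · simp [M, levelMem]
  · simp [M, levelMem]
  · simp [M, levelMem]
  · simp [M, levelMem]
  · simp only [bitsOf_length, List.length_replicate, length_edgeRows_flatten]
    ring_nf
    omega
  · funext k
    cases k <;> simp [M, levelMem, tableMem]

end StackProg

/-! ## Reading a game -/

/-- The bits of `p`, and of those rows of which the corresponding bit in the first list is set. -/
def unionRows : List Bool → List (List Bool) → List Bool → List Bool
  | q :: qs, r :: rs, p => unionRows qs rs (List.zipWith (fun p b => p || (q && b)) p r)
  | _, _, p => p

theorem zipWith_bitsOf {n : ℕ} (q : Bool) (p s : Fin n → Prop) :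
    List.zipWith (fun p b => p || (q && b)) (bitsOf p) (bitsOf s) =
      bitsOf fun v => p v ∨ (q = true ∧ s v) := by
  refine List.ext_getElem (by simp [bitsOf_length]) fun i h1 h2 => ?_
  rw [Bool.eq_iff_iff, StackProg.getElem_bitsOf, List.getElem_zipWith, Bool.or_eq_true,
    Bool.and_eq_true, StackProg.getElem_bitsOf, StackProg.getElem_bitsOf]

/-- Started from the empty set, with `q` the pawns of Player 1, this gives the vertices that he
controls. -/
theorem unionRows_bitsOf {n d : ℕ} (q : Fin d → Prop) (s : Fin d → Fin n → Prop) (p : Fin n → Prop) :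
    unionRows (bitsOf q) (List.ofFn fun j => bitsOf (s j)) (bitsOf p) =
      bitsOf fun v => p v ∨ ∃ j, q j ∧ s j v := by
  induction d generalizing p with
  | zero =>
    have e : bitsOf q = [] := by simp [bitsOf]
    rw [e, List.ofFn_zero, unionRows]
    · simp
    · simp
  | succ d ih =>
    have e : bitsOf q = (open Classical in decide (q 0)) :: bitsOf fun j => q (Fin.succ j) := by
      simp [bitsOf]
    rw [e, List.ofFn_succ, unionRows, zipWith_bitsOf, ih]
    congr 1
    funext v
    simp [Fin.exists_fin_succ, or_assoc]

namespace StackProg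

variable {Δ : Type} {a : List Γ'} {o : List Δ} {w : BitStack → List Bool} {i : BitStack}

theorem encodeRow_cons_append (b : Bool) (l : List Bool) (t : List Γ') :
    encodeRow (b :: l) ++ t = .bit b :: (encodeRow l ++ t) := by
  simp [encodeRow]

theorem encodeRows_cons_append (r : List Bool) (L : List (List Bool)) (t : List Γ') :
    encodeRows (r :: L) ++ t = r.map Γ'.bit ++ .comma :: (encodeRows L ++ t) := by
  simp [encodeRows, encodeRow]

theorem Exec.readRow_pushBit {r l : List Bool} (hw : w i = l) :
    (readRow (StackProg.pushBit i)).Exec (2 * r.length + 1) (mem (encodeRow r ++ a) o w)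
      (mem a o (update w i (r.reverse ++ l))) := by
  induction r generalizing w l with
  | nil => exact Exec.readRow_exit.to (by simp) (by simp [← hw])
  | cons b r ih =>
    rw [encodeRow_cons_append]
    refine (Exec.readRow_step (.pushBit b hw) (ih (l := b :: l) (by simp))).to ?_ ?_
    · rw [List.length_cons]
      omega
    · simp

theorem Exec.readRows_row {p : StackProg (Alphabet Δ)} {S' : ∀ k, List (Alphabet Δ k)} {B : ℕ}
    {r l : List Bool} (hw : w i = l)
    (h : (readRows (StackProg.pushBit i) p).Exec B (mem a o (update w i (r.reverse ++ l))) S') :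
    (readRows (StackProg.pushBit i) p).Exec (B + 2 * r.length) (mem (r.map Γ'.bit ++ a) o w) S' := by
  induction r generalizing w l with
  | nil => simpa [← hw] using h
  | cons b r ih =>
    refine (Exec.readRows_bit (.pushBit b hw) (ih (l := b :: l) (by simp) ?_)).mono ?_
    · simpa using h
    · rw [List.length_cons]
      omega

theorem Exec.readRows_pushBit {rs : List (List Bool)} {n : ℕ} (hn : ∀ r ∈ rs, r.length = n)
    {l : List Bool} (hw : w i = l) :
    (readRows (StackProg.pushBit i) StackProg.skip).Exec (rs.length * (2 * n + 2) + 1)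
      (mem (encodeRows rs ++ a) o w) (mem a o (update w i (rs.flatten.reverse ++ l))) := by
  induction rs generalizing w l with
  | nil => exact Exec.readRows_exit.to (by simp) (by simp [← hw])
  | cons r rs ih =>
    rw [encodeRows_cons_append]
    refine (Exec.readRows_row hw (.readRows_comma .skip (ih (fun r h => hn r (by simp [h]))
      (update_self ..)))).to ?_ ?_
    · rw [hn r (by simp), List.length_cons]
      ring_nf
      omega
    · simp

/-- Read a bit of the characteristic vector of the target, and initialize the other stacks. -/
def initVertex (b : Bool) : StackProg (Alphabet Δ) :=
  (pushBit .base' b).seq <| (pushBit .ones true).seq <| (pushBit .rounds true).seq <|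
    (pushBit .owned false).seq <| (pushBit .table false).seq (pushBit .reach false)

/-- The contents of the stacks while a game is read. -/
def parseMem (n : ℕ) (base' edges target owned pawns : List Bool) : BitStack → List Bool
  | .base' => base'
  | .edges => edges
  | .target => target
  | .owned => owned
  | .pawns => pawns
  | .ones => .replicate n true
  | .rounds => .replicate n true
  | .table => .replicate n false
  | .reach => .replicate n false
  | _ => []

/-- The first row has one bit per vertex, so it also supplies all counters and initial vectors of
length `n`. -/
theorem Exec.readRow_initVertex {m : ℕ} {r l : List Bool} :
    (readRow StackProg.initVertex).Exec (7 * r.length + 1)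
      (mem (encodeRow r ++ a) o (parseMem m l [] [] (.replicate m false) []))
      (mem a o (parseMem (m + r.length) (r.reverse ++ l) [] []
        (.replicate (m + r.length) false) [])) := by
  induction r generalizing m l with
  | nil => exact Exec.readRow_exit
  | cons b r ih =>
    rw [encodeRow_cons_append]
    have h1 : (StackProg.initVertex b).Exec 6
        (mem (encodeRow r ++ a) o (parseMem m l [] [] (.replicate m false) []))
        (mem (encodeRow r ++ a) o (parseMem (m + 1) (b :: l) [] [] (.replicate (m + 1) false) [])) := by
      refine Exec.to (B := 6) (.seq (.pushBit b (l := l) ?_) (.seq (.pushBit true (l := .replicate m true) ?_)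
        (.seq (.pushBit true (l := .replicate m true) ?_)
        (.seq (.pushBit false (l := .replicate m false) ?_)
        (.seq (.pushBit false (l := .replicate m false) ?_)
        (.pushBit false (l := .replicate m false) ?_)))))) le_rfl ?_
      all_goals try simp [parseMem]
      funext k
      cases k <;> simp [parseMem, List.replicate_succ]
    refine (Exec.readRow_step h1 (ih (m := m + 1) (l := b :: l))).to ?_ ?_
    · rw [List.length_cons]
      omega
    · simp [add_right_comm, ← add_assoc]

/-- Read a bit of the characteristic vector of a set of owned vertices. -/
def readOwned (b : Bool) : StackProg (Alphabet Δ) :=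
  popBit .pawns fun q => (pushBit .pawns q).seq <| popBit .owned fun p =>
    pushBit .owned' (p || (q && b))

/-- Finish the row of a pawn. -/
def nextPawn : StackProg (Alphabet Δ) := popBit .pawns fun _ => move .owned' .owned

/-- The bit of the current pawn stays on top of `pawns` during its whole row and is discarded only
by `nextPawn`. -/
theorem Exec.readOwned_row {S' : ∀ k, List (Alphabet Δ k)} {B : ℕ} {q : Bool}
    {qs p p' r : List Bool} (hq : w .pawns = q :: qs) (hp : w .owned = p) (hp' : w .owned' = p')
    (hr : p.length = r.length)
    (h : (readRows StackProg.readOwned nextPawn).Exec B (mem a o (update (update w .owned [])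
      .owned' ((List.zipWith (fun p b => p || (q && b)) p r).reverse ++ p'))) S') :
    (readRows StackProg.readOwned nextPawn).Exec (B + 5 * r.length)
      (mem (r.map Γ'.bit ++ a) o w) S' := by
  induction r generalizing w p p' with
  | nil =>
    obtain rfl : p = [] := by simpa using hr
    have e : update (update w .owned []) .owned' p' = w := by
      rw [← hp, update_eq_self, ← hp', update_eq_self]
    simpa [e] using h
  | cons b r ih =>
    obtain _ | ⟨x, p⟩ := p
    · simp at hr
    have h1 : ∀ a, (StackProg.readOwned b).Exec 4 (mem a o w)
        (mem a o (update (update w .owned p) .owned' ((x || (q && b)) :: p'))) := by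
      intro a
      refine (Exec.popBit (f := fun q => (StackProg.pushBit .pawns q).seq <|
        StackProg.popBit .owned fun p => StackProg.pushBit .owned' (p || (q && b))) hq
        (.seq (.pushBit q (l := qs) ?_) (Exec.popBit
        (f := fun p => StackProg.pushBit .owned' (p || (q && b))) (b := x) (l := p) ?_
        (.pushBit _ (l := p') ?_)))).to le_rfl ?_
      · simp
      · simpa using hp
      · simpa using hp'
      · funext k
        cases k <;> simp [hq]
    refine (Exec.readRows_bit (h1 _) (ih (p := p) (p' := (x || (q && b)) :: p') ?_ ?_ ?_ ?_ ?_)).mono ?_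
    · simpa using hq
    · simp
    · simp
    · simpa using hr
    · convert h using 2
      funext k
      cases k <;> simp
    · rw [List.length_cons]
      omega

theorem Exec.readRows_readOwned {n : ℕ} {rs : List (List Bool)} (hn : ∀ r ∈ rs, r.length = n)
    {qs p : List Bool} (hq : w .pawns = qs) (hqs : qs.length = rs.length) (hp : w .owned = p)
    (hpn : p.length = n) (hp' : w .owned' = []) :
    (readRows StackProg.readOwned nextPawn).Exec (rs.length * (7 * n + 3) + 1)
      (mem (encodeRows rs ++ a) o w)
      (mem a o (update (update w .pawns []) .owned (unionRows qs rs p))) := by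
  induction rs generalizing w qs p with
  | nil =>
    obtain rfl : qs = [] := by simpa using hqs
    refine Exec.readRows_exit.to (by simp) ?_
    rw [unionRows, ← hq, update_eq_self, ← hp, update_eq_self]
    · simp
  | cons r rs ih =>
    obtain _ | ⟨q, qs⟩ := qs
    · simp at hqs
    have hr : r.length = n := hn r (by simp)
    have hz : (List.zipWith (fun p b => p || (q && b)) p r).length = n := by
      simp [hpn, hr]
    rw [encodeRows_cons_append]
    refine (Exec.readOwned_row hq hp hp' (hpn.trans hr.symm) (.readRows_comma
      (Exec.popBit (f := fun _ => StackProg.move .owned' .owned) (b := q) (l := qs) ?_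
      (.move (by decide) (l := (List.zipWith (fun p b => p || (q && b)) p r).reverse) (l' := []) ?_ ?_))
      (ih (qs := qs) (p := List.zipWith (fun p b => p || (q && b)) p r)
      (fun r h => hn r (by simp [h])) ?_ (by simpa using hqs) ?_ hz ?_))).to ?_ ?_
    · simpa using hq
    · simp
    · simp
    · simp
    · simp
    · simp
    · simp only [List.length_reverse, hz, List.length_cons, hr]
      ring_nf
      omega
    · funext k
      cases k <;> simp [unionRows, hp']

/-- Read a game. -/
def readGame : StackProg (Alphabet Δ) :=
  (readRow initVertex).seq <| (move .base' .target).seq <| (readRows (pushBit .edges') skip).seq <|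
    (move .edges' .edges).seq <| (readRow (pushBit .base')).seq <| (move .base' .pawns).seq
      (readRows readOwned nextPawn)

theorem Exec.readGame (G : OVPPGame) : readGame.Exec (40 * (G.n + 1) ^ 2)
    (mem (G.encode ++ a) o fun _ => [])
    (mem a o (levelMem G.game.E G.game.T (G.game.controlled G.P₀) (.replicate G.n false)
      (.replicate G.n true) [] [] [] (.replicate G.n false) (.replicate G.n true))) := by
  obtain ⟨n, d, g, hg, P⟩ := G
  -- The number of rows for the pawns is `d`; the time bound is in terms of `n` alone.
  have hd : d = n := by simpa using hg.1.symm
  have h0 : (fun _ => [] : BitStack → List Bool) = parseMem 0 [] [] [] (.replicate 0 false) [] := by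
    funext k
    cases k <;> rfl
  have hu := unionRows_bitsOf (· ∈ P) (fun j => (· ∈ g.owned j)) (fun _ : Fin n => False)
  have hf : bitsOf (fun _ : Fin n => False) = .replicate n false := bitsOf_empty
  rw [hf] at hu
  simp only [OVPPGame.encode, List.append_assoc, h0]
  refine Exec.to (B := 7 * (bitsOf (· ∈ g.T)).length + 1 + (2 * (bitsOf (· ∈ g.T)).reverse.length + 1 +
    ((edgeRows g.E).length * (2 * n + 2) + 1 + (2 * (edgeRows g.E).flatten.reverse.length + 1 +
    (2 * (bitsOf (· ∈ P)).length + 1 + (2 * (bitsOf (· ∈ P)).reverse.length + 1 +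
    ((List.ofFn fun j => bitsOf (· ∈ g.owned j)).length * (7 * n + 3) + 1)))))))
    (.seq .readRow_initVertex (.seq
    (.move (by decide) (l := (bitsOf (· ∈ g.T)).reverse) (l' := []) ?_ ?_) (.seq
    (.readRows_pushBit (rs := edgeRows g.E) (n := n) (l := []) ?_ ?_) (.seq
    (.move (by decide) (l := (edgeRows g.E).flatten.reverse) (l' := []) ?_ ?_) (.seq
    (.readRow_pushBit (l := []) ?_) (.seq
    (.move (by decide) (l := (bitsOf (· ∈ P)).reverse) (l' := []) ?_ ?_)
    (.readRows_readOwned (n := n) (rs := List.ofFn fun j => bitsOf (· ∈ g.owned j))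
      (qs := bitsOf (· ∈ P)) (p := .replicate n false) ?_ ?_ ?_ ?_ ?_ ?_))))))) ?_ ?_
  all_goals try (simp [parseMem, bitsOf_length, edgeRows]; done)
  · simp only [List.length_reverse, length_edgeRows_flatten, bitsOf_length, List.length_ofFn, hd,
      show (edgeRows g.E).length = n by simp [edgeRows]]
    ring_nf
    omega
  · rw [hu]
    funext k
    cases k <;> simp [parseMem, levelMem, bitsOf_length, PawnGame.controlled]

/-- Read a game, and compute its table. -/
def gameTable : StackProg (Alphabet Δ) := readGame.seq computeTable

theorem Exec.gameTable (G : OVPPGame) : gameTable.Exec (240 * (G.n + 1) ^ 4)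
    (mem (G.encode ++ a) o fun _ => [])
    (mem a o (tableMem G.game.E G.game.T (G.game.controlled G.P₀))) := by
  refine ((Exec.readGame G).seq .computeTable).mono ?_
  have : (G.n + 1) ^ 2 ≤ (G.n + 1) ^ 4 := Nat.pow_le_pow_right (by omega) (by omega)
  omega

end StackProg

/-! ## The output of the table -/

section MinGrabs

variable {n : ℕ} {E : Fin n → Fin n → Prop} {T P : Set (Fin n)} {u : Fin n} {k : ℕ}

/-- By monotonicity in the number of grabs, only the first `k` levels can be losing. -/
theorem lossCount_le_of_configWins (h : ConfigWins E T P k u) (r : ℕ) :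
    lossCount E T P r u ≤ k := by
  induction r with
  | zero => exact Nat.zero_le k
  | succ r ih =>
    by_cases hr : r + 1 ≤ k
    · exact (lossCount_le _ _).trans hr
    · rw [lossCount, if_pos (configWins_iff_mem.1 (h.mono (by omega)))]
      exact ih

/-- Again by monotonicity, the first `k + 1` levels, testing `0` to `k` grabs, are all losing. -/
theorem le_lossCount_of_not_configWins (h : ¬ ConfigWins E T P k u) (r : ℕ) :
    min r (k + 1) ≤ lossCount E T P r u := by
  induction r with
  | zero => simp
  | succ r ih =>
    rw [lossCount]
    by_cases hr : r ≤ k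
    · rw [if_neg fun hm => h ((configWins_iff_mem.2 hm).mono hr)]
      omega
    · omega

/-- For `k + 1 < n` the count itself decides; for larger `k` the levels are stable, and the
hypothesis says that Player 1 wins there. -/
theorem lossCount_le_iff (h : u ∈ stepSet E T P (level E T P n)) :
    lossCount E T P n u ≤ k ↔ ConfigWins E T P k u := by
  refine ⟨fun hk => ?_, fun hk => lossCount_le_of_configWins hk n⟩
  by_contra hn
  have h1 := le_lossCount_of_not_configWins hn n
  by_cases hkn : n ≤ k + 1
  · refine hn ((configWins_iff_of_card_le (by simpa using hkn)).2 ?_)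
    rwa [Nat.card_fin]
  · omega

theorem not_configWins_of_notMem (h : u ∉ stepSet E T P (level E T P n)) :
    ¬ ConfigWins E T P k u := fun hk => h <| by
  -- A win with `k` grabs is also a win with `max k n`, where the levels are stable.
  have := (configWins_iff_of_card_le (r := max k n)
    (by simp; omega)).1 (hk.mono (le_max_left k n))
  rwa [Nat.card_fin] at this

end MinGrabs

open Classical in
theorem PawnGame.minGrabs_eq {n d : ℕ} {G : PawnGame (Fin n) d} (hG : G.IsOVPP)
    (P₀ : Finset (Fin d)) (u : Fin n) :
    G.minGrabs P₀ u = if u ∈ stepSet G.E G.T (G.controlled P₀) (level G.E G.T (G.controlled P₀) n)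
      then (lossCount G.E G.T (G.controlled P₀) n u : ℕ∞) else ⊤ := by
  have key : ∀ k : ℕ, G.minGrabs P₀ u ≤ k ↔ ConfigWins G.E G.T (G.controlled P₀) k u :=
    fun k => (minGrabs_le_iff hG).trans (winsKGrabbing_iff_configWins hG)
  split_ifs with h
  · refine le_antisymm ((key _).2 ((lossCount_le_iff h).1 le_rfl)) ?_
    rcases hm : G.minGrabs P₀ u with _ | m
    · exact le_top
    · refine Nat.cast_le.2 ((lossCount_le_iff h).2 ((key m).1 ?_))
      rw [hm]
      rfl
  · rcases hm : G.minGrabs P₀ u with _ | m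
    · rfl
    · refine absurd ((key m).1 ?_) (not_configWins_of_notMem h)
      rw [hm]
      rfl

/-- The entries of the table. -/
def tableEntries (cs : List Bool) (ms : List ℕ) : List ℕ∞ :=
  List.zipWith (fun (c : Bool) (m : ℕ) => if c = true then (m : ℕ∞) else ⊤) cs ms

theorem tableEntries_eq {n d : ℕ} {G : PawnGame (Fin n) d} (hG : G.IsOVPP) (P₀ : Finset (Fin d)) :
    tableEntries
      (bitsOf (· ∈ stepSet G.E G.T (G.controlled P₀) (level G.E G.T (G.controlled P₀) n)))
      (List.ofFn (lossCount G.E G.T (G.controlled P₀) n)) = List.ofFn (G.minGrabs P₀) := by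
  refine List.ext_getElem (by simp [bitsOf_length, tableEntries]) fun i h1 h2 => ?_
  classical
  simp only [tableEntries, List.getElem_zipWith, List.getElem_ofFn, PawnGame.minGrabs_eq hG]
  exact if_congr (StackProg.getElem_bitsOf _) rfl rfl

namespace StackProg

variable {Δ : Type} {a : List Γ'} {o : List Δ} {w : BitStack → List Bool}

/-- Write an entry of the table to the input stack. -/
def writeEntry (c : Bool) : StackProg (Alphabet Δ) :=
  (forTrue .table (if c then pushInp (.bit true) else skip)).seq <|
    (if c then skip else pushInp (.bit false)).seq (pushInp .comma)

theorem Exec.forTrue_pushInp {m : ℕ} {l : List Bool}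
    (hw : w .table = List.replicate m true ++ false :: l) :
    (forTrue .table (StackProg.pushInp (.bit true))).Exec (2 * m + 1) (mem a o w)
      (mem (List.replicate m (.bit true) ++ a) o (update w .table l)) := by
  induction m generalizing w a with
  | zero => exact (Exec.forTrue_exit (by simpa using hw)).mono (by omega)
  | succ m ih =>
    have h := ih (w := update w .table (List.replicate m true ++ false :: l)) (a := .bit true :: a)
      (by simp)
    rw [update_idem] at h
    refine Exec.mono (Exec.forTrue_step (by simpa [List.replicate_succ] using hw)
      (.pushInp (.bit true)) ?_) (B := 1 + (2 * m + 1) + 1) (by omega)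
    convert h using 2
    simp [List.replicate_succ']

theorem Exec.forTrue_skip {m : ℕ} {l : List Bool}
    (hw : w .table = List.replicate m true ++ false :: l) :
    (forTrue .table StackProg.skip).Exec (2 * m + 1) (mem a o w)
      (mem a o (update w .table l)) := by
  induction m generalizing w with
  | zero => exact (Exec.forTrue_exit (by simpa using hw)).mono (by omega)
  | succ m ih =>
    refine (Exec.forTrue_step (by simpa [List.replicate_succ] using hw)
      .skip (ih (update_self ..))).to (by omega) (update_idem ..)

theorem Exec.writeEntry {c : Bool} {m : ℕ} {l : List Bool}
    (hw : w .table = List.replicate m true ++ false :: l) :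
    (writeEntry c).Exec (2 * m + 3) (mem a o w)
      (mem ((encodeENat (if c = true then (m : ℕ∞) else ⊤)).reverse ++ a) o
        (update w .table l)) := by
  cases c
  · exact ((Exec.forTrue_skip hw).seq (.seq (.pushInp (.bit false)) (.pushInp .comma))).mono
      (by omega)
  · have e : (encodeENat (if true = true then (m : ℕ∞) else ⊤)).reverse =
        .comma :: List.replicate m (.bit true) := by
      rw [if_pos rfl]
      change (encodeRow (List.replicate m true)).reverse = _
      simp [encodeRow]
    rw [e]
    exact ((Exec.forTrue_pushInp hw).seq (.seq .skip (.pushInp .comma))).mono (by omega)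

/-- Write the table to the input stack, and move it to the output stack. -/
def writeTable : StackProg (Alphabet Γ') :=
  (forBits .won writeEntry).seq <|
    loop (Γ := Alphabet Γ') .inp (fun x : Option Γ' => x.isNone) fun
      | some x => pushOut x
      | none => skip

/-- By now the input has been read, so its stack is free to collect the output in reverse;
`Exec.moveOut` restores the order. -/
theorem Exec.forBits_writeEntry {cs : List Bool} {ms : List ℕ} {M : ℕ} (hM : ∀ m ∈ ms, m ≤ M)
    (hl : cs.length = ms.length) (hc : w .won = cs) (hw : w .table = unaryList ms) :
    (forBits .won StackProg.writeEntry).Exec (ms.length * (2 * M + 4) + 1) (mem a o w)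
      (mem ((encodeENats (tableEntries cs ms)).reverse ++ a) o
        (update (update w .won []) .table [])) := by
  induction cs generalizing w a ms with
  | nil =>
    obtain rfl : ms = [] := by simpa using hl.symm
    refine (Exec.forBits_nil hc).to (by simp) ?_
    funext k
    cases k <;> simp [hc, hw, unaryList]
  | cons c cs ih =>
    obtain _ | ⟨m, ms⟩ := ms
    · simp at hl
    have hm := hM m (by simp)
    have h := ih (w := update (update w .won cs) .table (unaryList ms)) (ms := ms)
      (a := (encodeENat (if c = true then (m : ℕ∞) else ⊤)).reverse ++ a)
      (fun m h => hM m (by simp [h])) (by simpa using hl) (by simp) (by simp)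
    have e : (encodeENats (tableEntries (c :: cs) (m :: ms))).reverse ++ a =
        (encodeENats (tableEntries cs ms)).reverse ++
          ((encodeENat (if c = true then (m : ℕ∞) else ⊤)).reverse ++ a) := by
      simp [tableEntries, encodeENats]
    rw [e]
    refine (Exec.forBits_cons hc (.writeEntry (m := m) (l := unaryList ms) ?_) h).to ?_ ?_
    · simpa [unaryList_cons] using hw
    · rw [List.length_cons]
      ring_nf
      omega
    · funext k
      cases k <;> simp

theorem Exec.moveOut {o : List Γ'} :
    (loop (Γ := Alphabet Γ') .inp (fun x : Option Γ' => x.isNone) fun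
      | some x => StackProg.pushOut x
      | none => StackProg.skip).Exec (2 * a.length + 1) (mem a o w) (mem [] (a.reverse ++ o) w) := by
  induction a generalizing o with
  | nil =>
    have h := Exec.loop_exit (Γ := Alphabet Γ') (k := .inp) (S := mem [] o w)
      (exit := fun x : Option Γ' => x.isNone)
      (f := fun
        | some x => StackProg.pushOut x
        | none => StackProg.skip) rfl
    change Exec _ _ _ (update (mem [] o w) .inp []) at h
    rwa [update_mem_inp] at h
  | cons x a ih =>
    refine (Exec.loop_step (Γ := Alphabet Γ') (S := mem (x :: a) o w) (B₁ := 1) (B₂ := 2 * a.length + 1)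
      (S₁ := mem a (x :: o) w) rfl ?_ ?_).mono ?_
    · change (StackProg.pushOut x).Exec _ (update (mem (x :: a) o w) .inp a) _
      rw [update_mem_inp]
      exact .pushOut x
    · simpa using ih (o := x :: o)
    · rw [List.length_cons]
      omega

theorem length_encodeENats_le {cs : List Bool} {ms : List ℕ} {M : ℕ} (hM : ∀ m ∈ ms, m ≤ M) :
    (encodeENats (tableEntries cs ms)).length ≤ ms.length * (M + 2) := by
  induction cs generalizing ms with
  | nil => simp [tableEntries, encodeENats]
  | cons c cs ih =>
    obtain _ | ⟨m, ms⟩ := ms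
    · simp [tableEntries, encodeENats]
    have hm := hM m (by simp)
    have h := ih (ms := ms) fun m h => hM m (by simp [h])
    have h1 : (encodeENat (if c = true then (m : ℕ∞) else ⊤)).length ≤ M + 2 := by
      cases c
      · change (encodeRow [false]).length ≤ _
        simp [encodeRow]
      · change (encodeRow (List.replicate m true)).length ≤ _
        simp [encodeRow]
        omega
    have e : encodeENats (tableEntries (c :: cs) (m :: ms)) =
        encodeENat (if c = true then (m : ℕ∞) else ⊤) ++ encodeENats (tableEntries cs ms) := by
      simp [tableEntries, encodeENats]
    rw [e, List.length_append, List.length_cons]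
    linarith

theorem Exec.writeTable {cs : List Bool} {ms : List ℕ} {M : ℕ} (hM : ∀ m ∈ ms, m ≤ M)
    (hl : cs.length = ms.length) (hc : w .won = cs) (hw : w .table = unaryList ms) :
    writeTable.Exec (ms.length * (4 * M + 8) + 2) (mem [] [] w)
      (mem [] (encodeENats (tableEntries cs ms)) (update (update w .won []) .table [])) := by
  have h := (Exec.forBits_writeEntry (a := []) (o := []) hM hl hc hw).seq Exec.moveOut
  simp only [List.append_nil, List.length_reverse, List.reverse_reverse] at h
  have hb := length_encodeENats_le (cs := cs) hM
  refine h.mono ?_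
  linarith

end StackProg

theorem OVPPGame.le_length_encode (G : OVPPGame) : G.n ≤ G.encode.length := by
  simp [OVPPGame.encode, encodeRow, bitsOf_length]

theorem update_nil_inp {Δ : Type} (l : List Γ') :
    (update (fun _ => []) .inp l : ∀ k, List (Alphabet Δ k)) = mem l [] fun _ => [] := by
  funext k
  rcases k with _ | _ | i <;> rfl

theorem update_nil_out {Δ : Type} (l : List Δ) :
    (update (fun _ => []) .out l : ∀ k, List (Alphabet Δ k)) = mem [] l fun _ => [] := by
  funext k
  rcases k with _ | _ | i <;> rfl

/-! ### Computing the table in polynomial time -/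

theorem polyTimeComputable_minGrabs : PolyTimeComputable OVPPGame.encode encodeENats
    (fun G => List.ofFn fun u : Fin G.n => G.game.minGrabs G.P₀ u) := by
  refine StackProg.polyTimeComputable (Γ := Alphabet Γ') (StackProg.gameTable.seq StackProg.writeTable)
    .inp .out (Equiv.refl _) (Equiv.refl _) _ _ _ (260 * (Polynomial.X + 1) ^ 4) fun G => ?_
  have h1 : ∀ l : List Γ', l.map (Equiv.refl Γ').symm = l := fun l => List.map_id l
  rw [h1, h1, update_nil_inp, update_nil_out]
  have h2 := StackProg.Exec.gameTable (Δ := Γ') (a := []) (o := []) G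
  rw [List.append_nil] at h2
  have h3 := h2.seq (StackProg.Exec.writeTable (M := G.n) 
    (cs := bitsOf (· ∈ stepSet G.game.E G.game.T (G.game.controlled G.P₀)
      (level G.game.E G.game.T (G.game.controlled G.P₀) G.n)))
    (ms := List.ofFn (lossCount G.game.E G.game.T (G.game.controlled G.P₀) G.n)) ?_ ?_ rfl rfl)
  · rw [tableEntries_eq G.isOVPP] at h3
    refine StackProg.Exec.to h3 ?_ ?_
    · have hn := G.le_length_encode
      have e : Polynomial.eval G.encode.length (260 * (Polynomial.X + 1) ^ 4 : Polynomial ℕ) =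
          260 * (G.encode.length + 1) ^ 4 := by simp
      rw [e]
      calc _ ≤ 260 * (G.n + 1) ^ 4 := by
            rw [List.length_ofFn]
            ring_nf
            omega
        _ ≤ _ := by gcongr
    · funext k
      cases k <;> simp [StackProg.tableMem]
  · intro m hm
    rw [List.mem_ofFn] at hm
    obtain ⟨u, rfl⟩ := hm
    exact lossCount_le _ _
  · simp [bitsOf_length]

/-! ## The decision problem -/

/-- The number with the given bits, the least significant one first. -/
def bitsValue : List Bool → ℕ
  | [] => 0
  | b :: l => b.toNat + 2 * bitsValue l

theorem bitsValue_encodeNat (k : ℕ) : bitsValue (encodeNat k) = k := by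
  have h : ∀ p : PosNum, bitsValue (encodePosNum p) = p := by
    intro p
    induction p with
    | one => rfl
    | bit0 p ih =>
      rw [encodePosNum, bitsValue, ih, PosNum.cast_bit0]
      simp
      omega
    | bit1 p ih =>
      rw [encodePosNum, bitsValue, ih, PosNum.cast_bit1]
      simp
      omega
  have h' : ∀ m : Num, bitsValue (encodeNum m) = m := by
    rintro (_ | p)
    · rfl
    · exact h p
  rw [encodeNat, h', Num.to_of_nat]

/-- Subtract the bit `y` from a number. -/
def subBits (y : Bool) : List Bool → List Bool
  | [] => []
  | b :: l => (b ^^ y) :: subBits (y && !b) l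

/-- The last borrow in the subtraction of the bit `y`. -/
def borrow (y : Bool) : List Bool → Bool
  | [] => y
  | b :: l => borrow (y && !b) l

theorem length_subBits (y : Bool) (l : List Bool) : (subBits y l).length = l.length := by
  induction l generalizing y with
  | nil => rfl
  | cons b l ih => simp [subBits, ih]

theorem bitsValue_lt (l : List Bool) : bitsValue l < 2 ^ l.length := by
  induction l with
  | nil => simp [bitsValue]
  | cons b l ih =>
    rw [bitsValue, List.length_cons, pow_succ]
    have := b.toNat_le
    omega

/-- A failed subtraction wraps around modulo the power of two, and the borrow records this. -/
theorem bitsValue_subBits (y : Bool) (l : List Bool) :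
    bitsValue l + (borrow y l).toNat * 2 ^ l.length = bitsValue (subBits y l) + y.toNat := by
  induction l generalizing y with
  | nil => simp [bitsValue, borrow, subBits]
  | cons b l ih =>
    have h := ih (y && !b)
    simp only [bitsValue, borrow, subBits, List.length_cons, pow_succ, ← mul_assoc]
    cases y <;> cases b <;> simp at h ⊢ <;> omega

theorem borrow_true_iff {l : List Bool} : borrow true l = true ↔ bitsValue l = 0 := by
  have h := bitsValue_subBits true l
  have h1 := bitsValue_lt l
  have h2 := bitsValue_lt (subBits true l)
  rw [length_subBits] at h2
  cases hb : borrow true l <;> simp [hb] at h ⊢ <;> omega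

/-- All vertices with a bit in the first list have a finite entry in the table, and their sum is at
most `K`. -/
def Affordable : List Bool → List Bool → List ℕ → ℕ → Prop
  | b :: vs, c :: cs, m :: ms, K =>
      if b = true then c = true ∧ m ≤ K ∧ Affordable vs cs ms (K - m) else Affordable vs cs ms K
  | _, _, _, _ => True

theorem affordable_of_forall {vs : List Bool} (h : ∀ b ∈ vs, b = false) (cs : List Bool)
    (ms : List ℕ) (K : ℕ) : Affordable vs cs ms K := by
  induction vs generalizing cs ms with
  | nil => simp [Affordable]
  | cons b vs ih =>
    obtain rfl := h b (by simp)
    obtain _ | ⟨c, cs⟩ := cs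
    · simp [Affordable]
    obtain _ | ⟨m, ms⟩ := ms
    · simp [Affordable]
    simpa [Affordable] using ih (fun b h' => h b (by simp [h'])) cs ms

/-- The characteristic vector of `v` marks one vertex only, so paying for all marked vertices means
paying the entry of `v`. The program can thus go through the table in parallel with the vector,
without computing positions. -/
theorem affordable_iff {n : ℕ} (v : Fin n) (c : Fin n → Prop) (m : Fin n → ℕ) (K : ℕ) :
    Affordable (bitsOf (· = v)) (bitsOf c) (List.ofFn m) K ↔ c v ∧ m v ≤ K := by
  classical
  induction n with
  | zero => exact v.elim0
  | succ n ih =>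
    have e : ∀ s : Fin (n + 1) → Prop, bitsOf s = decide (s 0) :: bitsOf fun i => s (Fin.succ i) := by
      intro s
      simp [bitsOf]
    rw [e, e, List.ofFn_succ, Affordable]
    induction v using Fin.cases with
    | zero =>
      have h : Affordable (bitsOf fun i : Fin n => Fin.succ i = 0) (bitsOf fun i => c (Fin.succ i))
          (List.ofFn fun i => m (Fin.succ i)) (K - m 0) := by
        refine affordable_of_forall (fun b hb => ?_) _ _ _
        rw [bitsOf, List.mem_ofFn] at hb
        obtain ⟨i, rfl⟩ := hb
        simp [Fin.succ_ne_zero]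
      rw [if_pos (by simp)]
      simp only [h]
      simp
    | succ v =>
      have h := ih v (fun i => c (Fin.succ i)) (fun i => m (Fin.succ i))
      simpa [(Fin.succ_ne_zero v).symm] using h

/-! ### Paying the entry of the initial vertex by binary subtraction -/

namespace StackProg

variable {Δ : Type} {a : List Γ'} {o : List Δ} {w : BitStack → List Bool}

/-- Subtract the bit on `flag` from a bit. -/
def subBit (b : Bool) : StackProg (Alphabet Δ) :=
  popBit .flag fun y => (pushBit .flag (y && !b)).seq (pushBit .base' (b ^^ y))

theorem Exec.forBits_subBit {y : Bool} {l l' : List Bool} (hl : w .rounds = l) (hf : w .flag = [y])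
    (hb : w .base' = l') :
    (forBits .rounds StackProg.subBit).Exec (4 * l.length + 1) (mem a o w)
      (mem a o (update (update (update w .rounds []) .flag [borrow y l])
        .base' ((subBits y l).reverse ++ l'))) := by
  induction l generalizing w y l' with
  | nil =>
    refine (Exec.forBits_nil hl).to (by simp) ?_
    funext k
    cases k <;> simp [hl, hf, hb, borrow, subBits]
  | cons b l ih =>
    refine (Exec.forBits_cons hl (Exec.popBit (f := fun y =>
      (StackProg.pushBit .flag (y && !b)).seq (StackProg.pushBit .base' (b ^^ y))) (b := y) (l := [])
      ?_ (.seq (.pushBit _ (l := []) ?_) (.pushBit _ (l := l') ?_)))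
      (ih (y := y && !b) (l' := (b ^^ y) :: l') ?_ ?_ ?_)).to ?_ ?_
    · simpa using hf
    · simp
    · simpa using hb
    · simp
    · simp
    · simp
    · rw [List.length_cons]
      omega
    · funext k
      cases k <;> simp [borrow, subBits]

/-- Subtract one from the number on `rounds`; on failure, push a bit on `acc`. -/
def decrement : StackProg (Alphabet Δ) :=
  (pushBit .flag true).seq <| (forBits .rounds subBit).seq <| (move .base' .rounds).seq <|
    popBit .flag fun y => if y then pushBit .acc true else skip

theorem Exec.decrement {l : List Bool} {f : ℕ} (hl : w .rounds = l)
    (ha : w .acc = .replicate f true) (hf : w .flag = []) (hb : w .base' = []) :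
    decrement.Exec (6 * l.length + 5) (mem a o w)
      (mem a o (update (update w .rounds (subBits true l)) .acc
        (.replicate (f + (borrow true l).toNat) true))) := by
  have h1 : (StackProg.popBit .flag fun y => if y = true then StackProg.pushBit .acc true
      else StackProg.skip).Exec 2
      (mem a o (update (update w .rounds (subBits true l)) .flag [borrow true l]))
      (mem a o (update (update w .rounds (subBits true l)) .acc
        (.replicate (f + (borrow true l).toNat) true))) := by
    refine Exec.popBit (b := borrow true l) (l := []) (by simp) ?_
    cases borrow true l
    · refine Exec.skip.to le_rfl ?_
      funext k
      cases k <;> simp [ha, hf]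
    · refine (Exec.pushBit true (l := .replicate f true) (by simpa using ha)).to le_rfl ?_
      funext k
      cases k <;> simp [List.replicate_succ, hf]
  have h2 := (Exec.pushBit (a := a) (o := o) true hf).seq ((Exec.forBits_subBit (y := true) (l := l)
    (l' := []) (by simpa using hl) (by simp) (by simpa using hb)).seq
    (.move (i := .base') (j := .rounds) (by decide) (l := (subBits true l).reverse) (l' := [])
      (by simp) (by simp)))
  have h3 : update (update (update (update (update (update w .flag [true]) .rounds [])
      .flag [borrow true l]) .base' ((subBits true l).reverse ++ [])) .base' [])
      .rounds ((subBits true l).reverse.reverse ++ []) =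
      update (update w .rounds (subBits true l)) .flag [borrow true l] := by
    funext k
    cases k <;> simp [hb]
  rw [h3] at h2
  obtain ⟨t, ht, hr⟩ := h2
  obtain ⟨t', ht', hr'⟩ := h1
  simp only [List.length_reverse, length_subBits] at ht
  cases hr with
  | seq r1 r2 =>
    cases r2 with
    | seq r2 r3 => exact ⟨_, by omega, .seq r1 (.seq r2 (.seq r3 hr'))⟩

/-- The number `f'` counts failures. Once there is one, the counter has wrapped around and its value
is meaningless, so the value is described only for `f' = 0`. The upper bound on `f'` is for the time
needed to clear `acc` at the end. -/
theorem Exec.forTrue_decrement {m f : ℕ} {l t : List Bool}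
    (hw : w .table = List.replicate m true ++ false :: t) (hl : w .rounds = l)
    (ha : w .acc = .replicate f true) (hf : w .flag = []) (hb : w .base' = []) :
    ∃ (l' : List Bool) (f' : ℕ), l'.length = l.length ∧ (f' = 0 ↔ f = 0 ∧ m ≤ bitsValue l) ∧
      f' ≤ f + m ∧
      (f' = 0 → bitsValue l' = bitsValue l - m) ∧
      (forTrue .table StackProg.decrement).Exec (m * (6 * l.length + 6) + 1) (mem a o w)
        (mem a o (update (update (update w .table t) .rounds l') .acc (.replicate f' true))) := by
  induction m generalizing w f l with
  | zero =>
    refine ⟨l, f, rfl, by simp, le_rfl, by simp, (Exec.forTrue_exit (by simpa using hw)).to (by omega) ?_⟩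
    funext k
    cases k <;> simp [hl, ha]
  | succ m ih =>
    obtain ⟨l', f', h1, h2, h2', h3, h4⟩ := ih
      (w := update (update (update w .table (List.replicate m true ++ false :: t))
        .rounds (subBits true l)) .acc (.replicate (f + (borrow true l).toNat) true))
      (l := subBits true l) (f := f + (borrow true l).toNat) (by simp) (by simp) (by simp)
      (by simpa using hf) (by simpa using hb)
    have h5 := bitsValue_subBits true l
    have h6 := borrow_true_iff (l := l)
    have h7 : f' = 0 ↔ f = 0 ∧ m + 1 ≤ bitsValue l := by
      rw [h2]
      cases hy : borrow true l <;> simp [hy] at h5 h6 ⊢ <;> omega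
    have h9 := (borrow true l).toNat_le
    refine ⟨l', f', h1.trans (length_subBits _ _), h7, by omega, fun h0 => ?_, ?_⟩
    · rw [h3 h0]
      have h8 := h7.1 h0
      cases hy : borrow true l <;> simp [hy] at h5 h6 ⊢ <;> omega
    · rw [length_subBits] at h4
      refine (Exec.forTrue_step (by simpa [List.replicate_succ] using hw)
        (.decrement (l := l) (f := f) ?_ ?_ ?_ ?_) h4).to ?_ ?_
      · simpa using hl
      · simpa using ha
      · simpa using hf
      · simpa using hb
      · ring_nf
        omega
      · funext k
        cases k <;> simp

/-- Pay for a vertex, if the bit `b` is set. -/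
def payVertex : Bool → Bool → StackProg (Alphabet Δ)
  | true, true => forTrue .table decrement
  | true, false => (forTrue .table skip).seq (pushBit .acc true)
  | false, _ => forTrue .table skip

theorem Exec.payVertex {b c : Bool} {m f : ℕ} {l t : List Bool}
    (hw : w .table = List.replicate m true ++ false :: t) (hl : w .rounds = l)
    (ha : w .acc = .replicate f true) (hf : w .flag = []) (hb : w .base' = []) :
    ∃ (l' : List Bool) (f' : ℕ), l'.length = l.length ∧
      (f' = 0 ↔ f = 0 ∧ (b = true → c = true ∧ m ≤ bitsValue l)) ∧
      f' ≤ f + (m + 1) ∧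
      (f' = 0 → bitsValue l' = bitsValue l - if b = true then m else 0) ∧
      (payVertex b c).Exec (m * (6 * l.length + 6) + 2) (mem a o w)
        (mem a o (update (update (update w .table t) .rounds l') .acc (.replicate f' true))) := by
  have h0 : 2 * m + 1 ≤ m * (6 * l.length + 6) + 1 := by
    have : m * 2 ≤ m * (6 * l.length + 6) := Nat.mul_le_mul_left _ (by omega)
    omega
  cases b
  · refine ⟨l, f, rfl, by simp, by omega, by simp, (Exec.forTrue_skip hw).to (by omega) ?_⟩
    funext k
    cases k <;> simp [hl, ha]
  · cases c
    · refine ⟨l, f + 1, rfl, by simp, by omega, by simp, ((Exec.forTrue_skip hw).seq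
        (.pushBit true (l := .replicate f true) (by simpa using ha))).to (by omega) ?_⟩
      funext k
      cases k <;> simp [hl, List.replicate_succ]
    · obtain ⟨l', f', h1, h2, h2', h3, h4⟩ := Exec.forTrue_decrement (a := a) (o := o) hw hl ha hf hb
      exact ⟨l', f', h1, by simpa using h2, by omega, by simpa using h3, h4.mono (by omega)⟩

/-- Pay for the vertices on `pawns`. -/
def payLoop : StackProg (Alphabet Δ) :=
  forBits .pawns fun b => popBit .won fun c => payVertex b c

theorem Exec.payLoop {vs cs : List Bool} {ms : List ℕ} {M f : ℕ} {l : List Bool}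
    (hM : ∀ m ∈ ms, m ≤ M) (hcs : cs.length = vs.length) (hms : ms.length = vs.length)
    (hv : w .pawns = vs) (hc : w .won = cs) (hw : w .table = unaryList ms) (hl : w .rounds = l)
    (ha : w .acc = .replicate f true) (hf : w .flag = []) (hb : w .base' = []) :
    ∃ (l' : List Bool) (f' : ℕ), l'.length = l.length ∧
      (f' = 0 ↔ f = 0 ∧ Affordable vs cs ms (bitsValue l)) ∧
      f' ≤ f + vs.length * (M + 1) ∧
      payLoop.Exec (vs.length * (M * (6 * l.length + 6) + 4) + 1) (mem a o w)
        (mem a o (update (update (update (update (update w .pawns []) .won []) .table [])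
          .rounds l') .acc (.replicate f' true))) := by
  induction vs generalizing w cs ms f l with
  | nil =>
    obtain rfl : cs = [] := by simpa using hcs
    obtain rfl : ms = [] := by simpa using hms
    refine ⟨l, f, rfl, by simp [Affordable], by simp, (Exec.forBits_nil hv).to (by simp) ?_⟩
    funext k
    cases k <;> simp [hv, hc, hw, hl, ha, unaryList]
  | cons b vs ih =>
    obtain _ | ⟨c, cs⟩ := cs
    · simp at hcs
    obtain _ | ⟨m, ms⟩ := ms
    · simp at hms
    have hm := hM m (by simp)
    obtain ⟨l₁, f₁, h1, h2, h2', h3, h4⟩ := Exec.payVertex (a := a) (o := o) (b := b) (c := c) (m := m)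
      (f := f) (l := l) (t := unaryList ms) (w := update (update w .pawns vs) .won cs)
      (by simpa [unaryList_cons] using hw) (by simpa using hl) (by simpa using ha) (by simpa using hf)
      (by simpa using hb)
    obtain ⟨l₂, f₂, h5, h6, h6', h7⟩ := ih
      (w := update (update (update (update (update w .pawns vs) .won cs) .table (unaryList ms))
        .rounds l₁) .acc (.replicate f₁ true)) (cs := cs) (ms := ms) (f := f₁) (l := l₁)
      (fun m h => hM m (by simp [h])) (by simpa using hcs) (by simpa using hms) (by simp) (by simp)
      (by simp) (by simp) (by simp) (by simpa using hf) (by simpa using hb)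
    refine ⟨l₂, f₂, h5.trans h1, ?_, by rw [List.length_cons]; linarith, (Exec.forBits_cons hv (Exec.popBit
      (f := fun c => StackProg.payVertex b c) (b := c) (l := cs) (by simpa using hc) h4) h7).to ?_ ?_⟩
    · rw [h6, Affordable]
      -- After a failure at this vertex the further payments are irrelevant, since the failure count
      -- never returns to zero.
      by_cases h0 : f₁ = 0
      · rw [h3 h0]
        have h8 := h2.1 h0
        cases b
        · simp [h0, h8.1]
        · have h9 := h8.2 rfl
          simp [h0, h8.1, h9.1, h9.2]
      · simp only [h0, false_and, false_iff]
        rintro ⟨rfl, h8⟩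
        refine h0 (h2.2 ⟨rfl, fun hb => ?_⟩)
        rw [if_pos hb] at h8
        exact ⟨h8.1, h8.2.1⟩
    · rw [List.length_cons, h1]
      have : m * (6 * l.length + 6) ≤ M * (6 * l.length + 6) := Nat.mul_le_mul_right _ hm
      ring_nf at *
      omega
    · funext k
      cases k <;> simp

/-- An empty stack reads as `false`. In `decideGrabs` this makes an empty `acc`, that is, no
failure, produce the answer `true`. -/
theorem Exec.popBit_nil {f : Bool → StackProg (Alphabet Δ)} {S' : ∀ k, List (Alphabet Δ k)} {B : ℕ}
    {i : BitStack} (hw : w i = []) (h : (f false).Exec B (mem a o w) S') :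
    (StackProg.popBit i f).Exec (B + 1) (mem a o w) S' := by
  obtain ⟨t, ht, hr⟩ := h
  refine ⟨t + 1, by omega, ?_⟩
  apply Run.case
  change (f (((w i).head?).getD false)).Run (update (mem a o w) (.bits i) (w i).tail) t S'
  rw [update_mem_bits, hw, List.tail_nil, ← hw, update_eq_self, hw]
  exact hr

/-- Read the initial vertex and the number of grabs, and compare with the table. -/
def decideGrabs : StackProg (Alphabet Bool) :=
  (readRow (pushBit .base')).seq <| (move .base' .pawns).seq <| (readRow (pushBit .base')).seq <|
    (move .base' .rounds).seq <| payLoop.seq <| (clear .rounds).seq <|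
      (popBit .acc fun x => pushOut (!x)).seq (clear .acc)

theorem Exec.decideGrabs {vs cs : List Bool} {ms : List ℕ} {M : ℕ} {l : List Bool}
    (hM : ∀ m ∈ ms, m ≤ M) (hcs : cs.length = vs.length) (hms : ms.length = vs.length)
    (hc : w .won = cs) (hw : w .table = unaryList ms)
    (h' : ∀ i, i ≠ .won → i ≠ .table → w i = []) {b : Bool}
    (hb : b = true ↔ Affordable vs cs ms (bitsValue l)) :
    decideGrabs.Exec (vs.length * (M * (6 * l.length + 6) + 2 * M + 10) + 6 * l.length + 20)
      (mem (encodeRow vs ++ (encodeRow l ++ [])) [] w) (mem [] [b] fun _ => []) := by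
  have h1 := (Exec.readRow_pushBit (Δ := Bool) (a := encodeRow l ++ []) (o := []) (w := w)
    (i := .base') (r := vs) (l := []) (h' _ (by decide) (by decide))).seq
    ((Exec.move (i := .base') (j := .pawns) (by decide) (l := vs.reverse) (l' := []) (by simp)
    (by simpa using h' _ (by decide) (by decide))).seq
    ((Exec.readRow_pushBit (i := .base') (a := []) (r := l) (l := []) (by simp)).seq
    (.move (i := .base') (j := .rounds) (by decide) (l := l.reverse) (l' := []) (by simp)
    (by simpa using h' _ (by decide) (by decide)))))
  have e1 : ∀ i, i ≠ .won → i ≠ .table → i ≠ .pawns → i ≠ .rounds →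
      update (update (update (update (update (update w .base' (vs.reverse ++ [])) .base' []) .pawns
        (vs.reverse.reverse ++ [])) .base' (l.reverse ++ [])) .base' []) .rounds
        (l.reverse.reverse ++ []) i = [] := by
    intro i h1 h2 h3 h4
    rw [update_of_ne h4]
    by_cases h5 : i = .base'
    · subst h5
      simp
    · simp [h5, h3, h' i h1 h2]
  obtain ⟨l', f, h2, h3, h4, h5⟩ := Exec.payLoop (a := []) (o := ([] : List Bool)) (vs := vs)
    (cs := cs) (ms := ms) (M := M) (f := 0) (l := l) hM hcs hms
    (w := update (update (update (update (update (update w .base' (vs.reverse ++ [])) .base' []) .pawns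
      (vs.reverse.reverse ++ [])) .base' (l.reverse ++ [])) .base' []) .rounds
      (l.reverse.reverse ++ []))
    (by simp) (by simpa using hc) (by simpa using hw) (by simp)
    (e1 _ (by decide) (by decide) (by decide) (by decide))
    (e1 _ (by decide) (by decide) (by decide) (by decide))
    (e1 _ (by decide) (by decide) (by decide) (by decide))
  have h6 : ((StackProg.popBit .acc fun x => StackProg.pushOut (!x)).seq
      (StackProg.clear .acc)).Exec (2 * f + 3)
      (mem [] [] (update (fun _ => []) .acc (List.replicate f true)))
      (mem [] [b] fun _ => []) := by
    rcases f with _ | f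
    · obtain rfl : b = true := hb.2 (h3.1 rfl).2
      refine (Exec.seq (Exec.popBit_nil (by simp) (.pushOut true))
        (.clear (l := []) (by simp))).to le_rfl ?_
      funext k
      cases k <;> simp
    · obtain rfl : b = false := by
        rw [← Bool.not_eq_true, hb]
        intro h
        have := h3.2 ⟨rfl, h⟩
        omega
      refine (Exec.seq (Exec.popBit (b := true) (l := List.replicate f true)
        (by simp [List.replicate_succ]) (.pushOut false))
        (.clear (l := List.replicate f true) (by simp))).to (by simp; omega) ?_
      funext k
      cases k <;> simp
  obtain ⟨t1, ht1, hr1⟩ := h1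
  have h7 := h5.seq ((Exec.clear (i := .rounds) (l := l') (by simp)).to
    (w' := update (fun _ => []) .acc (List.replicate f true)) le_rfl (by
      funext k
      by_cases h1 : k = .won
      · subst h1
        simp
      by_cases h2 : k = .table
      · subst h2
        simp
      by_cases h3 : k = .pawns
      · subst h3
        simp
      by_cases h4 : k = .rounds
      · subst h4
        simp
      by_cases h5 : k = .acc
      · subst h5
        simp
      · have := e1 k h1 h2 h3 h4
        simp only [update_of_ne h1, update_of_ne h2, update_of_ne h3, update_of_ne h4,
          update_of_ne h5] at this ⊢
        exact this))
  obtain ⟨t2, ht2, hr2⟩ := h7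
  obtain ⟨t3, ht3, hr3⟩ := h6
  rw [h2] at ht2
  simp only [List.length_reverse] at ht1
  cases hr1 with
  | seq r1 r =>
    cases r with
    | seq r2 r =>
      cases r with
      | seq r3 r4 =>
        cases hr2 with
        | seq r5 r6 =>
          refine ⟨_, ?_, .seq r1 (.seq r2 (.seq r3 (.seq r4 (.seq r5 (.seq r6 hr3)))))⟩
          ring_nf at *
          omega

end StackProg

open Classical in
theorem inPTIME_player1Wins : InPTIME OVPPKGrabbingInput.encode OVPPKGrabbingInput.Player1Wins := by
  refine StackProg.polyTimeComputable (Γ := Alphabet Bool)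
    (StackProg.gameTable.seq StackProg.decideGrabs)
    .inp .out (Equiv.refl _) (Equiv.refl _) _ _ _ (300 * (Polynomial.X + 1) ^ 4) fun I => ?_
  have h1 : ∀ {Γ : Type} (l : List Γ), l.map (Equiv.refl Γ).symm = l := fun l => List.map_id l
  rw [h1, h1, update_nil_inp, update_nil_out]
  obtain ⟨G, v₀, k⟩ := I
  have h2 := StackProg.Exec.gameTable (Δ := Bool)
    (a := encodeRow (bitsOf (· = v₀)) ++ (encodeRow (encodeNat k) ++ [])) (o := []) G
  have hb : decide (OVPPKGrabbingInput.Player1Wins ⟨G, v₀, k⟩) = true ↔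
      Affordable (bitsOf (· = v₀)) (bitsOf (· ∈ stepSet G.game.E G.game.T (G.game.controlled G.P₀)
      (level G.game.E G.game.T (G.game.controlled G.P₀) G.n)))
      (List.ofFn (lossCount G.game.E G.game.T (G.game.controlled G.P₀) G.n))
      (bitsValue (encodeNat k)) := by
    rw [decide_eq_true_iff, bitsValue_encodeNat, affordable_iff]
    change G.game.WinsKGrabbing k v₀ G.P₀ ↔ _
    rw [PawnGame.winsKGrabbing_iff_configWins G.isOVPP]
    -- An entry of the table is meaningful only at vertices with a finite minimum; at the others no
    -- number of grabs suffices.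
    by_cases h : v₀ ∈ stepSet G.game.E G.game.T (G.game.controlled G.P₀)
      (level G.game.E G.game.T (G.game.controlled G.P₀) G.n)
    · simp only [h, true_and, lossCount_le_iff h]
    · simp only [h, false_and, iff_false]
      exact not_configWins_of_notMem h
  have h3 := h2.seq (StackProg.Exec.decideGrabs (M := G.n) ?_ ?_ ?_ rfl rfl ?_ hb)
  · have e2 : OVPPKGrabbingInput.encode ⟨G, v₀, k⟩ =
        G.encode ++ (encodeRow (bitsOf (· = v₀)) ++ (encodeRow (encodeNat k) ++ [])) := by
      simp [OVPPKGrabbingInput.encode]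
    rw [← e2] at h3
    refine StackProg.Exec.to h3 ?_ rfl
    have e3 : G.n + (encodeNat k).length ≤ (OVPPKGrabbingInput.encode ⟨G, v₀, k⟩).length := by
      have := G.le_length_encode
      rw [e2]
      simp [encodeRow]
      omega
    generalize (OVPPKGrabbingInput.encode ⟨G, v₀, k⟩).length = L at *
    have e4 : Polynomial.eval L (300 * (Polynomial.X + 1) ^ 4 : Polynomial ℕ) =
        300 * (L + 1) ^ 4 := by simp
    have hn : G.n ≤ L := by omega
    have hk : (encodeNat k).length ≤ L := by omega
    rw [e4, bitsOf_length]
    -- At most `n` decrements are made for an entry, each linear in the number of bits of `k`, so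
    -- the size of `k` itself does not enter.
    calc _ ≤ 240 * (L + 1) ^ 4 + (L * (L * (6 * L + 6) + 2 * L + 10) + 6 * L + 20) := by gcongr
      _ ≤ _ := by
        ring_nf
        omega
  · intro m hm
    rw [List.mem_ofFn] at hm
    obtain ⟨u, rfl⟩ := hm
    exact lossCount_le _ _
  · simp [StackProg.tableMem, bitsOf_length]
  · simp [bitsOf_length]
  · intro i h1 h2
    cases i <;> simp [StackProg.tableMem] at h1 h2 ⊢

theorem mainTheorem6 :
    InPTIME OVPPKGrabbingInput.encode OVPPKGrabbingInput.Player1Wins ∧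
    (∀ (G : OVPPGame) (u : Fin G.n) (k : ℕ),
      G.game.WinsKGrabbing k u G.P₀ ↔ G.game.minGrabs G.P₀ u ≤ (k : ℕ∞)) ∧
    PolyTimeComputable OVPPGame.encode encodeENats
      (fun G => List.ofFn fun u : Fin G.n => G.game.minGrabs G.P₀ u) :=
  ⟨inPTIME_player1Wins, fun G _ _ => (PawnGame.minGrabs_le_iff G.isOVPP).symm,
    polyTimeComputable_minGrabs⟩
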